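/- Let $\phi:\mathbf R\to\mathbf R$ be a Lipschitz function with $\|\phi'\|_{L^\infty(\mathbf R)}\le k$ and let $\Omega=\{X=(x,t)\in\mathbf R^2 : \phi(x)<t\}$, with arc length measure $\sigma$ on $\partial\Omega$. Let $A=A(x)=\begin{pmatrix}1 & c(x)\\ 0 & d(x)\end{pmatrix}$ be a real matrix of measurable functions, independent of $t$, with entries bounded by $\Lambda$ and satisfying $\lambda|\xi|^2\le \xi\cdot A\xi$ for all $\xi\in\mathbf R^2$, where $\lambda>0$. Let $u\in W^{1,2}_{\rm loc}(\Omega)$ be a weak solution of $\operatorname{div}(A\nabla u)=0$ in $\Omega$ such that, for every $\delta>0$, $u(X)=O(|X|^{\delta-1})$ and $|\nabla u(X)|=O(|X|^{\delta-2})$ as $|X|\to\infty$ in $\Omega$. Two functions $v,w\in W^{1,2}_{\rm loc}(\Omega)$ form a conjugate pair $(v,w)$ if $$\begin{pmatrix}0&1\\-1&0\end{pmatrix}\nabla w=A\nabla v\quad\text{a.e. in }\Omega .$$ Then $u_t=\partial_t u$ has a conjugate which tends to $0$ as $|X|\to\infty$ in $\Omega$, that is, there is a conjugate pair $(u_t,\widetilde{u_t})$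 with $\widetilde{u_t}(X)\to0$ as $|X|\to\infty$ in $\Omega$. Moreover, for any such $\widetilde{u_t}$ and each $1<p<\infty$ there is a constant $C(p)>0$, depending only on $\lambda,\Lambda,k$ and $p$, such that, whenever $\nabla u$ has boundary values on $\partial\Omega$, so does $\widetilde{u_t}$, and $$\|\widetilde{u_t}\|_{L^p(\partial\Omega)}\le C(p)\,\|\nabla u\|_{L^p(\partial\Omega)}$$ (the right-hand side may be infinite). Here $F$ is the boundary function of $f$ if $F$ is $\sigma$-measurable and, for $\sigma$-almost every $Q\in\partial\Omega$, $F(Q)$ is the (essential) limit of $f(Q+(0,h))$ as $h\searrow0$. -/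

import Mathlib

open MeasureTheory Filter Topology
open scoped Matrix ContDiff NNReal ENNReal

/-- The domain `Ω = {(x, t) : φ x < t}` above the graph of `φ`. -/
def graphDomain (φ : ℝ → ℝ) : Set (ℝ × ℝ) := {X | φ X.1 < X.2}

/-- Surface (arc length) measure `dσ = (1 + φ'(x)²)^{1/2} dx` on the graph `∂Ω` of `φ`,
as a measure on the plane carried by the graph. -/
noncomputable def surfaceMeasure (φ : ℝ → ℝ) : Measure (ℝ × ℝ) :=
  Measure.map (fun x => (x, φ x))
    ((volume : Measure ℝ).withDensity fun x => ENNReal.ofReal (Real.sqrt (1 + deriv φ x ^ 2)))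

/-- Euclidean length of a point of the plane. -/
noncomputable def absPt (X : ℝ × ℝ) : ℝ := Real.sqrt (X.1 ^ 2 + X.2 ^ 2)

/-- Euclidean length of a vector (gradients are written as vectors indexed by `Fin 2`:
index `0` is the `x`-component and index `1` is the `t`-component). -/
noncomputable def absVec (v : Fin 2 → ℝ) : ℝ := Real.sqrt (v 0 ^ 2 + v 1 ^ 2)

/-- The classical gradient `(ψ_x, ψ_t)` of a differentiable function on the plane. -/
noncomputable def planeGradient (ψ : ℝ × ℝ → ℝ) (X : ℝ × ℝ) : Fin 2 → ℝ :=
  ![fderiv ℝ ψ X (1, 0), fderiv ℝ ψ X (0, 1)]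

/-- Test functions: smooth functions with compact support contained in `U`. -/
structure IsTestFunction (U : Set (ℝ × ℝ)) (ψ : ℝ × ℝ → ℝ) : Prop where
  smooth : ContDiff ℝ ∞ ψ
  compact : HasCompactSupport ψ
  support : tsupport ψ ⊆ U

/-- `f` belongs to `L²(K)` for every compact `K ⊆ U`. -/
def MemL2Loc (U : Set (ℝ × ℝ)) (f : ℝ × ℝ → ℝ) : Prop :=
  ∀ K ⊆ U, IsCompact K → MemLp f 2 (volume.restrict K)

/-- `f ∈ W^{1,2}_loc(U)` and `g` is (a representative of) its weak gradient in `U`. -/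
structure HasWeakGradient (U : Set (ℝ × ℝ)) (f : ℝ × ℝ → ℝ) (g : ℝ × ℝ → Fin 2 → ℝ) : Prop where
  memL2Loc : MemL2Loc U f
  gradient_memL2Loc : ∀ i, MemL2Loc U fun X => g X i
  weak : ∀ ψ, IsTestFunction U ψ → ∀ i,
    ∫ X in U, f X * planeGradient ψ X i = - ∫ X in U, g X i * ψ X

/-- The coefficient matrix `A = A(x)` has measurable entries bounded by `Lam` and satisfies
`lam |ξ|² ≤ ξ · A ξ`. -/
structure IsElliptic (lam Lam : ℝ) (A : ℝ → Matrix (Fin 2) (Fin 2) ℝ) : Prop where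
  measurable : ∀ i j, AEMeasurable (fun x => A x i j) volume
  bounded : ∀ᵐ x : ℝ, ∀ i j, |A x i j| ≤ Lam
  elliptic : ∀ᵐ x : ℝ, ∀ ξ : Fin 2 → ℝ, lam * absVec ξ ^ 2 ≤ ξ ⬝ᵥ (A x *ᵥ ξ)

/-- `f ∈ W^{1,2}_loc(U)`, with weak gradient `g`, is a weak solution of `div (A ∇f) = 0` in `U`,
where the coefficients `A = A(x)` do not depend on the `t`-variable. -/
structure IsWeakSolution (A : ℝ → Matrix (Fin 2) (Fin 2) ℝ) (U : Set (ℝ × ℝ))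
    (f : ℝ × ℝ → ℝ) (g : ℝ × ℝ → Fin 2 → ℝ) : Prop where
  hasWeakGradient : HasWeakGradient U f g
  equation : ∀ ψ, IsTestFunction U ψ →
    ∫ X in U, (A X.1 *ᵥ g X) ⬝ᵥ planeGradient ψ X = 0

/-- `(v, w)` is a conjugate pair for `div (A ∇ ·)` in `U`: both functions lie in `W^{1,2}_loc(U)`
and `(0 1; -1 0) ∇w = A ∇v` almost everywhere in `U`. -/
def IsConjugatePair (A : ℝ → Matrix (Fin 2) (Fin 2) ℝ) (U : Set (ℝ × ℝ))
    (v w : ℝ × ℝ → ℝ) : Prop :=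
  ∃ gv gw : ℝ × ℝ → Fin 2 → ℝ, HasWeakGradient U v gv ∧ HasWeakGradient U w gw ∧
    ∀ᵐ X ∂(volume.restrict U), !![0, 1; -1, 0] *ᵥ gw X = A X.1 *ᵥ gv X

/-- `w(X) → 0` as `|X| → ∞`, `X ∈ U` (up to null sets). -/
def VanishesAtInfinity (U : Set (ℝ × ℝ)) (w : ℝ × ℝ → ℝ) : Prop :=
  ∀ ε > 0, ∃ R : ℝ, ∀ᵐ X ∂(volume.restrict U), R ≤ absPt X → |w X| ≤ ε

/-- `|f(X)| = O(|X|^{s})` as `|X| → ∞`, `X ∈ U` (up to null sets). -/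
def IsBigOPow (U : Set (ℝ × ℝ)) (f : ℝ × ℝ → ℝ) (s : ℝ) : Prop :=
  ∃ M R : ℝ, ∀ᵐ X ∂(volume.restrict U), R ≤ absPt X → |f X| ≤ M * absPt X ^ s

/-- `F` is the boundary function of `f` on the graph of `φ`: `F` is measurable and, for
`σ`-almost every boundary point `Q`, it is the limit of `f (Q + (0, h))` as `h ↘ 0`. The limit is
an essential one (null sets of `h` are ignored), so that the notion does not change when `f` is
modified on a null set of the plane. -/
structure HasBoundaryValues (φ : ℝ → ℝ) (f F : ℝ × ℝ → ℝ) : Prop where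
  measurable : AEStronglyMeasurable F (surfaceMeasure φ)
  tendsto : ∀ᵐ Q ∂(surfaceMeasure φ),
    Tendsto (fun h : ℝ => f (Q.1, Q.2 + h)) (𝓝[>] (0 : ℝ) ⊓ ae volume) (𝓝 (F Q))

/-! The conjugate is explicit. Because the first column of `A` is `(1, 0)`, the equation reads `∂_x
(u_x + c u_t) + ∂_t (d u_t) = 0`. Put `w = u_x + c u_t`. As `c` and `d` do not depend on `t`, `w_t =
u_xt + c u_tt` and, by the equation, `w_x = -d u_tt`. These are the two rows of the conjugacy
relation for `(u_t, w)`. Moreover `|w| ≤ (1 + Λ)|∇u|` pointwise. This gives decay at infinity and,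
on the boundary, the `L^p` estimate with constant `1 + |Λ|` for every `p`; no singular integral
enters.

Two points need work. The first is regularity: `∇u` must have a weak `t`-derivative in `L²_loc`.
Since `A` is independent of `t`, the difference `u(· + (0, h)) - u` is again a solution. The
Caccioppoli inequality bounds its gradient by its own `L²` norm, which is at most `h` times a local
norm of `u_t`. Letting `h ↘ 0` and using Riesz duality gives the derivative
(`IsWeakSolution.caccioppoli`, `IsWeakSolution.exists_vertical_deriv`). Only upward shifts occur,
and these preserve the domain above a graph.

The second is uniqueness: any conjugate of `u_t` has the same `t`-derivative as `w`. A function with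
zero `t`-derivative can be followed upwards to infinity, so it vanishes if it tends to zero there
(`ae_eq_zero_of_vertical_deriv_eq_zero`). Hence every admissible conjugate equals `u_x + c u_t`
almost everywhere. Its vertical boundary limits follow from those of `∇u`, since `c` is constant on
vertical lines. -/

/-! ### Test functions and local square integrability -/

/-- The coordinate directions of the plane. -/
def planeDir : Fin 2 → ℝ × ℝ := ![(1, 0), (0, 1)]

theorem planeGradient_eq (ψ : ℝ × ℝ → ℝ) (X : ℝ × ℝ) (i : Fin 2) :
    planeGradient ψ X i = fderiv ℝ ψ X (planeDir i) := by
  fin_cases i <;> rfl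

namespace IsTestFunction

variable {U : Set (ℝ × ℝ)} {ψ χ : ℝ × ℝ → ℝ}

theorem differentiable (h : IsTestFunction U ψ) : Differentiable ℝ ψ :=
  h.smooth.differentiable (by simp)

theorem eq_zero_of_notMem (h : IsTestFunction U ψ) {X : ℝ × ℝ} (hX : X ∉ U) : ψ X = 0 :=
  image_eq_zero_of_notMem_tsupport fun h' => hX (h.support h')

theorem mono {V : Set (ℝ × ℝ)} (h : IsTestFunction U ψ) (hV : tsupport ψ ⊆ V) :
    IsTestFunction V ψ :=
  ⟨h.smooth, h.compact, hV⟩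

theorem partialDeriv (h : IsTestFunction U ψ) (i : Fin 2) :
    IsTestFunction U fun X => planeGradient ψ X i := by
  simp only [planeGradient_eq]
  refine ⟨?_, h.compact.fderiv_apply ℝ _, (tsupport_fderiv_apply_subset ℝ _).trans h.support⟩
  exact (h.smooth.fderiv_right (m := ∞) (by simp)).clm_apply contDiff_const

theorem mul_left (h : IsTestFunction U ψ) (hχ : ContDiff ℝ ∞ χ) :
    IsTestFunction U fun X => χ X * ψ X :=
  ⟨hχ.mul h.smooth, h.compact.mul_left, (tsupport_mul_subset_right).trans h.support⟩

theorem add (h : IsTestFunction U ψ) (h' : IsTestFunction U χ) :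
    IsTestFunction U fun X => ψ X + χ X :=
  ⟨h.smooth.add h'.smooth, h.compact.add h'.compact,
    (tsupport_add ψ χ).trans (Set.union_subset h.support h'.support)⟩

theorem const_mul (h : IsTestFunction U ψ) (a : ℝ) : IsTestFunction U fun X => a * ψ X :=
  h.mul_left contDiff_const

theorem planeGradient_mul (h : Differentiable ℝ ψ) (h' : Differentiable ℝ χ) (X : ℝ × ℝ)
    (i : Fin 2) : planeGradient (fun X => ψ X * χ X) X i =
      ψ X * planeGradient χ X i + χ X * planeGradient ψ X i := by
  simp only [planeGradient_eq]
  rw [fderiv_fun_mul (h X) (h' X)]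
  simp

theorem planeGradient_add (h : Differentiable ℝ ψ) (h' : Differentiable ℝ χ) (X : ℝ × ℝ)
    (i : Fin 2) : planeGradient (fun X => ψ X + χ X) X i =
      planeGradient ψ X i + planeGradient χ X i := by
  simp only [planeGradient_eq]
  rw [fderiv_fun_add (h X) (h' X)]
  simp

theorem planeGradient_const_mul (h : Differentiable ℝ ψ) (a : ℝ) (X : ℝ × ℝ)
    (i : Fin 2) : planeGradient (fun X => a * ψ X) X i = a * planeGradient ψ X i := by
  simp only [planeGradient_eq]
  rw [fderiv_const_mul (h X)]
  simp

theorem planeGradient_comp_sub (Y X : ℝ × ℝ) (i : Fin 2) :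
    planeGradient (fun X => ψ (X - Y)) X i = planeGradient ψ (X - Y) i := by
  simp only [planeGradient_eq]
  rw [fderiv_comp_sub]

theorem tsupport_comp_sub (ψ : ℝ × ℝ → ℝ) (Y : ℝ × ℝ) :
    tsupport (fun X => ψ (X - Y)) = (fun X => X - Y) ⁻¹' tsupport ψ :=
  tsupport_comp_eq_preimage ψ (Homeomorph.subRight Y)

theorem comp_sub {V : Set (ℝ × ℝ)} (h : IsTestFunction U ψ) (Y : ℝ × ℝ)
    (hV : ∀ X ∈ tsupport ψ, X + Y ∈ V) : IsTestFunction V fun X => ψ (X - Y) := by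
  refine ⟨h.smooth.comp (contDiff_id.sub contDiff_const),
    h.compact.comp_homeomorph (Homeomorph.subRight Y), ?_⟩
  rw [tsupport_comp_sub]
  intro X hX
  simpa using hV _ hX

theorem integral_mul (h : IsTestFunction U ψ) (f : ℝ × ℝ → ℝ) :
    ∫ X in U, f X * ψ X = ∫ X, f X * ψ X :=
  setIntegral_eq_integral_of_forall_compl_eq_zero fun X hX => by simp [h.eq_zero_of_notMem hX]

theorem memLp (h : IsTestFunction U ψ) : MemLp ψ 2 volume :=
  h.smooth.continuous.memLp_of_hasCompactSupport h.compact

theorem exists_bound (h : IsTestFunction U ψ) : ∃ C : ℝ, 0 ≤ C ∧ ∀ X, |ψ X| ≤ C := by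
  obtain ⟨C, hC⟩ := h.compact.exists_bound_of_continuous h.smooth.continuous
  exact ⟨C, (norm_nonneg _).trans (hC 0), hC⟩

end IsTestFunction

theorem exists_testFunction_eq_one {K U : Set (ℝ × ℝ)} (hK : IsCompact K) (hU : IsOpen U)
    (hKU : K ⊆ U) : ∃ η, IsTestFunction U η ∧ ∀ X ∈ K, η X = 1 := by
  obtain ⟨V, hV, hKV, hVU, hVc⟩ := exists_open_between_and_isCompact_closure hK hU hKU
  obtain ⟨η, h1, -, h3, h4⟩ := exists_contMDiff_support_eq_eq_one_iff (n := ⊤)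
    (modelWithCornersSelf ℝ (ℝ × ℝ)) hV hK.isClosed hKV
  refine ⟨η, ⟨h1.contDiff, ?_, ?_⟩, fun X hX => (h4 X).1 hX⟩
  · rw [HasCompactSupport, tsupport, h3]
    exact hVc
  · rw [tsupport, h3]
    exact hVU

theorem abs_integral_mul_le_sqrt {f g : ℝ × ℝ → ℝ} (hf : MemLp f 2 volume)
    (hg : MemLp g 2 volume) : |∫ X, f X * g X| ≤ √(∫ X, f X ^ 2) * √(∫ X, g X ^ 2) := by
  have key : ∀ {a b : ℝ × ℝ → ℝ} (ha : MemLp a 2 volume) (hb : MemLp b 2 volume),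
      inner ℝ (ha.toLp a) (hb.toLp b) = ∫ X, a X * b X := by
    intro a b ha hb
    rw [L2.inner_def]
    refine integral_congr_ae ?_
    filter_upwards [ha.coeFn_toLp, hb.coeFn_toLp] with X h1 h2
    simp [h1, h2, mul_comm]
  have h := abs_real_inner_le_norm (hf.toLp f) (hg.toLp g)
  rw [key, norm_eq_sqrt_real_inner, norm_eq_sqrt_real_inner, key, key] at h
  simpa only [sq] using h

namespace MemL2Loc

variable {U : Set (ℝ × ℝ)} {f g ψ : ℝ × ℝ → ℝ}

theorem memLp_indicator (hf : MemL2Loc U f) {K : Set (ℝ × ℝ)} (hK : IsCompact K) (hKU : K ⊆ U) :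
    MemLp (K.indicator f) 2 volume :=
  (memLp_indicator_iff_restrict hK.measurableSet).2 (hf K hKU hK)

theorem integrable_indicator (hf : MemL2Loc U f) {K : Set (ℝ × ℝ)} (hK : IsCompact K)
    (hKU : K ⊆ U) : Integrable (K.indicator f) volume := by
  rw [integrable_indicator_iff hK.measurableSet]
  have : IsFiniteMeasure ((volume : Measure (ℝ × ℝ)).restrict K) :=
    ⟨by simpa using hK.measure_lt_top⟩
  exact (hf K hKU hK).integrable (by norm_num)

theorem indicator_mul_eq {K : Set (ℝ × ℝ)} (h : tsupport ψ ⊆ K) (X : ℝ × ℝ) :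
    K.indicator f X * ψ X = f X * ψ X := by
  by_cases hX : X ∈ K
  · simp [hX]
  · simp [image_eq_zero_of_notMem_tsupport fun h' => hX (h h')]

theorem memLp_mul (hf : MemL2Loc U f) (hψ : IsTestFunction U ψ) :
    MemLp (fun X => f X * ψ X) 2 volume := by
  obtain ⟨C, -, hC⟩ := hψ.exists_bound
  have h1 := hf.memLp_indicator hψ.compact hψ.support
  simp only [← indicator_mul_eq (f := f) (subset_refl (tsupport ψ))]
  refine h1.of_le_mul (c := C) (h1.1.mul hψ.smooth.continuous.aestronglyMeasurable)
    (.of_forall fun X => ?_)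
  rw [norm_mul, mul_comm]
  exact mul_le_mul_of_nonneg_right (hC X) (norm_nonneg _)

theorem integrable_mul (hf : MemL2Loc U f) (hψ : IsTestFunction U ψ) :
    Integrable (fun X => f X * ψ X) volume := by
  simp only [← indicator_mul_eq (f := f) (subset_refl (tsupport ψ))]
  exact (hf.memLp_indicator hψ.compact hψ.support).integrable_mul hψ.memLp

theorem locallyIntegrableOn (hf : MemL2Loc U f) (hU : IsOpen U) :
    LocallyIntegrableOn f U volume := by
  rw [locallyIntegrableOn_iff hU.isLocallyClosed]
  intro K hKU hK
  exact (integrable_indicator_iff hK.measurableSet).1 (hf.integrable_indicator hK hKU)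

theorem ae_eq_zero (hf : MemL2Loc U f) (hU : IsOpen U)
    (h : ∀ ψ, IsTestFunction U ψ → ∫ X, f X * ψ X = 0) : ∀ᵐ X, X ∈ U → f X = 0 := by
  refine hU.ae_eq_zero_of_integral_contDiff_smul_eq_zero (hf.locallyIntegrableOn hU) ?_
  intro ψ h1 h2 h3
  simpa only [smul_eq_mul, mul_comm] using h ψ ⟨h1, h2, h3⟩

theorem mono {V : Set (ℝ × ℝ)} (hf : MemL2Loc U f) (hV : V ⊆ U) : MemL2Loc V f :=
  fun K hKV hK => hf K (hKV.trans hV) hK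

theorem add (hf : MemL2Loc U f) (hg : MemL2Loc U g) : MemL2Loc U fun X => f X + g X :=
  fun K hKU hK => (hf K hKU hK).add (hg K hKU hK)

theorem sub (hf : MemL2Loc U f) (hg : MemL2Loc U g) : MemL2Loc U fun X => f X - g X :=
  fun K hKU hK => (hf K hKU hK).sub (hg K hKU hK)

theorem bdd_mul (hf : MemL2Loc U f) {m : ℝ → ℝ} {C : ℝ} (hm : AEMeasurable m volume)
    (hC : ∀ᵐ x, |m x| ≤ C) : MemL2Loc U fun X => m X.1 * f X := by
  intro K hKU hK
  have hq : Measure.QuasiMeasurePreserving (Prod.fst : ℝ × ℝ → ℝ) volume volume :=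
    Measure.quasiMeasurePreserving_fst
  have h1 : AEStronglyMeasurable (fun X : ℝ × ℝ => m X.1) volume :=
    (hm.comp_quasiMeasurePreserving hq).aestronglyMeasurable
  have h2 : ∀ᵐ X : ℝ × ℝ, |m X.1| ≤ C := hq.ae hC
  refine (hf K hKU hK).of_le_mul (c := C) (h1.restrict.mul (hf K hKU hK).1) ?_
  filter_upwards [ae_restrict_of_ae h2] with X hX
  rw [norm_mul]
  exact mul_le_mul_of_nonneg_right hX (norm_nonneg _)

theorem const_mul (hf : MemL2Loc U f) (a : ℝ) : MemL2Loc U fun X => a * f X :=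
  fun K hKU hK => (hf K hKU hK).const_mul a

theorem comp_add (hf : MemL2Loc U f) {V : Set (ℝ × ℝ)} (Y : ℝ × ℝ) (hV : ∀ X ∈ V, X + Y ∈ U) :
    MemL2Loc V fun X => f (X + Y) := by
  intro K hKV hK
  rw [← memLp_indicator_iff_restrict hK.measurableSet]
  have hK' : IsCompact ((fun X => X + Y) '' K) := hK.image (by fun_prop)
  have h1 := hf.memLp_indicator hK' (by rintro _ ⟨X, hX, rfl⟩; exact hV X (hKV hX))
  have h2 := h1.comp_measurePreserving (measurePreserving_add_right volume Y)
  have h3 : (K.indicator fun X => f (X + Y)) =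
      ((fun X => X + Y) '' K).indicator f ∘ fun X => X + Y := by
    funext X
    by_cases hX : X ∈ K <;> simp [Set.indicator, hX]
  rw [h3]
  exact h2

end MemL2Loc

theorem MeasureTheory.MemLp.memL2Loc {f : ℝ × ℝ → ℝ} (hf : MemLp f 2 volume)
    (U : Set (ℝ × ℝ)) : MemL2Loc U f :=
  fun _ _ _ => hf.restrict _

theorem integral_comp_add_mul (f ψ : ℝ × ℝ → ℝ) (Y : ℝ × ℝ) :
    ∫ X, f (X + Y) * ψ X = ∫ X, f X * ψ (X - Y) := by
  rw [← integral_add_right_eq_self (fun X => f X * ψ (X - Y)) Y]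
  simp

/-! ### Difference quotients and duality -/

theorem hasDerivAt_integral_mul_comp_sub {F ψ : ℝ × ℝ → ℝ} {U : Set (ℝ × ℝ)} (hF : Integrable F)
    (hψ : IsTestFunction U ψ) (s : ℝ) :
    HasDerivAt (fun s : ℝ => ∫ X, F X * ψ (X - (0, s)))
      (-∫ X, F X * planeGradient ψ (X - (0, s)) 1) s := by
  obtain ⟨C, hC0, hC⟩ := (hψ.partialDeriv 1).exists_bound
  obtain ⟨D, hD0, hD⟩ := hψ.exists_bound
  have hm : ∀ s : ℝ, AEStronglyMeasurable (fun X : ℝ × ℝ => ψ (X - (0, s))) volume := fun s =>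
    (hψ.smooth.continuous.comp (by fun_prop)).aestronglyMeasurable
  have hm' : ∀ s : ℝ, AEStronglyMeasurable
      (fun X : ℝ × ℝ => planeGradient ψ (X - (0, s)) 1) volume := fun s =>
    ((hψ.partialDeriv 1).smooth.continuous.comp (g := fun X => planeGradient ψ X 1)
      (f := fun X : ℝ × ℝ => X - (0, s)) (by fun_prop)).aestronglyMeasurable
  rw [← integral_neg]
  refine (hasDerivAt_integral_of_dominated_loc_of_deriv_le (bound := fun X => C * |F X|)
    (F' := fun s X => -(F X * planeGradient ψ (X - (0, s)) 1)) univ_mem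
    (.of_forall fun s => hF.1.mul (hm s)) ?_ (hF.1.mul (hm' s)).neg ?_ (hF.abs.const_mul C) ?_).2
  · exact hF.mul_bdd (c := D) (hm s) (.of_forall fun X => hD _)
  · refine .of_forall fun X s _ => ?_
    rw [norm_neg, norm_mul, mul_comm]
    exact mul_le_mul_of_nonneg_right (hC _) (norm_nonneg _)
  · refine .of_forall fun X s _ => ?_
    have h1 : HasDerivAt (fun s : ℝ => X - ((0 : ℝ), s)) (-((0 : ℝ), (1 : ℝ))) s :=
      ((hasDerivAt_const s (0 : ℝ)).prodMk (hasDerivAt_id s)).const_sub X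
    have h2 := ((hψ.differentiable (X - (0, s))).hasFDerivAt.comp_hasDerivAt s h1).const_mul (F X)
    have h3 : F X * fderiv ℝ ψ (X - (0, s)) (-((0 : ℝ), (1 : ℝ))) =
        -(F X * planeGradient ψ (X - (0, s)) 1) := by
      rw [planeGradient_eq, map_neg, mul_neg]
      simp [planeDir]
    rw [← h3]
    exact h2

/-- This is the bound `‖f(· + (0, h)) - f‖ ≤ h ‖f_t‖` in dual form, with `q` as the weak
`t`-derivative of `f`. The pairing of `f` with the translate of `ψ` by `(0, s)` has `s`-derivative
equal to the pairing with `q`, so the mean value inequality and Cauchy–Schwarz apply. The compact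
set `K` has to contain all the translated supports. The case `q = 0` is used for uniqueness. -/
theorem abs_integral_mul_comp_sub_sub_le {U K : Set (ℝ × ℝ)} {f q ψ : ℝ × ℝ → ℝ} {h : ℝ}
    (hf : MemL2Loc U f) (hq : MemL2Loc U q)
    (hfq : ∀ ψ, IsTestFunction U ψ → ∫ X, f X * planeGradient ψ X 1 = -∫ X, q X * ψ X)
    (hK : IsCompact K) (hKU : K ⊆ U) (hψ : IsTestFunction U ψ) (hh : 0 ≤ h)
    (hψK : ∀ X ∈ tsupport ψ, ∀ s ∈ Set.Icc 0 h, X + (0, s) ∈ K) :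
    |∫ X, f X * (ψ (X - (0, h)) - ψ X)| ≤
      h * (√(∫ X, K.indicator q X ^ 2) * √(∫ X, ψ X ^ 2)) := by
  have hFi := hf.integrable_indicator hK hKU
  have hsub : ∀ s ∈ Set.Icc 0 h, IsTestFunction K fun X => ψ (X - (0, s)) := fun s hs =>
    hψ.comp_sub _ fun X hX => hψK X hX s hs
  have hsubU : ∀ s ∈ Set.Icc 0 h, IsTestFunction U fun X => ψ (X - (0, s)) := fun s hs =>
    (hsub s hs).mono ((hsub s hs).support.trans hKU)
  have hJ : ∀ s ∈ Set.Icc 0 h, ∫ X, K.indicator f X * ψ (X - (0, s)) =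
      ∫ X, f X * ψ (X - (0, s)) := fun s hs => by
    simp only [MemL2Loc.indicator_mul_eq (hsub s hs).support]
  have hd : ∀ s ∈ Set.Icc 0 h, HasDerivWithinAt
      (fun s : ℝ => ∫ X, K.indicator f X * ψ (X - (0, s))) (∫ X, q X * ψ (X - (0, s)))
      (Set.Icc 0 h) s := fun s hs => by
    have h1 := (hasDerivAt_integral_mul_comp_sub hFi hψ s).hasDerivWithinAt (s := Set.Icc 0 h)
    have h2 : -∫ X, K.indicator f X * planeGradient ψ (X - (0, s)) 1 =
        ∫ X, q X * ψ (X - (0, s)) := by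
      rw [neg_eq_iff_eq_neg, ← hfq _ (hsubU s hs)]
      refine integral_congr_ae (.of_forall fun X => ?_)
      simp only [← IsTestFunction.planeGradient_comp_sub (ψ := ψ)]
      exact MemL2Loc.indicator_mul_eq (((hsub s hs).partialDeriv 1).support) X
    rw [← h2]
    exact h1
  have hb : ∀ s ∈ Set.Icc 0 h, ‖∫ X, q X * ψ (X - (0, s))‖ ≤
      √(∫ X, K.indicator q X ^ 2) * √(∫ X, ψ X ^ 2) := fun s hs => by
    have h1 := abs_integral_mul_le_sqrt (hq.memLp_indicator hK hKU) (hsub s hs).memLp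
    simp only [MemL2Loc.indicator_mul_eq (hsub s hs).support] at h1
    rwa [integral_sub_right_eq_self (fun X => ψ X ^ 2) ((0 : ℝ), s)] at h1
  have h0 : (0 : ℝ) ∈ Set.Icc 0 h := ⟨le_rfl, hh⟩
  have h1 : h ∈ Set.Icc 0 h := ⟨hh, le_rfl⟩
  have key := (convex_Icc 0 h).norm_image_sub_le_of_norm_hasDerivWithin_le hd hb h0 h1
  rw [hJ 0 h0, hJ h h1, sub_zero, Real.norm_eq_abs, Real.norm_of_nonneg hh,
    ← integral_sub (hf.integrable_mul (hsubU h h1)) (hf.integrable_mul (hsubU 0 h0)),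
    mul_comm] at key
  simpa [mul_sub, Prod.mk_zero_zero] using key

/-- A linear functional on test functions which is bounded in the `L²` norm is given by
integration against an `L²` function. -/
theorem exists_memLp_two_of_abs_le {U : Set (ℝ × ℝ)} {T : (ℝ × ℝ → ℝ) → ℝ} {M : ℝ} (hM : 0 ≤ M)
    (hadd : ∀ ψ χ, IsTestFunction U ψ → IsTestFunction U χ →
      T (fun X => ψ X + χ X) = T ψ + T χ)
    (hsmul : ∀ (a : ℝ) (ψ), IsTestFunction U ψ → T (fun X => a * ψ X) = a * T ψ)
    (hT : ∀ ψ, IsTestFunction U ψ → |T ψ| ≤ M * √(∫ X, ψ X ^ 2)) :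
    ∃ q : ℝ × ℝ → ℝ, MemLp q 2 volume ∧ ∫ X, q X ^ 2 ≤ M ^ 2 ∧
      ∀ ψ, IsTestFunction U ψ → T ψ = ∫ X, q X * ψ X := by
  let S : Submodule ℝ (ℝ × ℝ → ℝ) :=
    { carrier := {ψ | IsTestFunction U ψ}
      add_mem' := fun h h' => h.add h'
      zero_mem' := ⟨contDiff_const, HasCompactSupport.zero, by simp [tsupport]⟩
      smul_mem' := fun a ψ h => h.const_mul a }
  let ι : S →ₗ[ℝ] Lp ℝ 2 (volume : Measure (ℝ × ℝ)) :=
    { toFun := fun ψ => (IsTestFunction.memLp ψ.2).toLp ψ.1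
      map_add' := fun _ _ => rfl
      map_smul' := fun _ _ => rfl }
  let T' : S →ₗ[ℝ] ℝ :=
    { toFun := fun ψ => T ψ.1
      map_add' := fun ψ χ => hadd _ _ ψ.2 χ.2
      map_smul' := fun a ψ => hsmul a _ ψ.2 }
  have hnorm : ∀ g : Lp ℝ 2 (volume : Measure (ℝ × ℝ)), ‖g‖ = √(∫ X, g X ^ 2) := fun g => by
    rw [norm_eq_sqrt_real_inner, L2.inner_def]
    simp [sq]
  have hι : ∀ ψ : S, ‖ι ψ‖ = √(∫ X, ψ.1 X ^ 2) := fun ψ => by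
    rw [hnorm]
    congr 1
    refine integral_congr_ae ?_
    filter_upwards [(IsTestFunction.memLp ψ.2).coeFn_toLp] with X hX
    rw [← hX]
    rfl
  have hle : ∀ ψ : S, |T' ψ| ≤ M * ‖ι ψ‖ := fun ψ => by
    rw [hι]
    exact hT _ ψ.2
  -- The bound makes `T` depend only on the `L²` class of `ψ`. It therefore descends to a bounded
  -- functional on the range of `ι`, to which Hahn–Banach and then Riesz representation apply.
  have hker : ι.ker ≤ T'.ker := fun ψ hψ => by
    have h1 := hle ψ
    rw [LinearMap.mem_ker.1 hψ, norm_zero, mul_zero] at h1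
    exact abs_nonpos_iff.1 h1
  let R : ι.range →ₗ[ℝ] ℝ := (ι.ker.liftQ T' hker).comp ι.quotKerEquivRange.symm.toLinearMap
  have hR : ∀ ψ : S, R ⟨ι ψ, LinearMap.mem_range_self ι ψ⟩ = T' ψ := fun ψ => by
    have h1 : ι.quotKerEquivRange.symm ⟨ι ψ, LinearMap.mem_range_self ι ψ⟩ =
        ι.ker.mkQ ψ := by
      rw [LinearEquiv.symm_apply_eq]
      rfl
    simp only [R, LinearMap.comp_apply, LinearEquiv.coe_coe, h1]
    rfl
  have hRb : ∀ x, ‖R x‖ ≤ M * ‖x‖ := by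
    rintro ⟨_, ψ, rfl⟩
    rw [hR]
    exact hle ψ
  obtain ⟨L, hL, hLn⟩ := exists_extension_norm_eq ι.range (R.mkContinuous M hRb)
  set q := (InnerProductSpace.toDual ℝ _).symm L with hq
  have hqn : ‖q‖ ≤ M := by
    rw [hq, LinearIsometryEquiv.norm_map, hLn]
    exact LinearMap.mkContinuous_norm_le _ hM _
  refine ⟨q, Lp.memLp q, ?_, fun ψ hψ => ?_⟩
  · rw [hnorm] at hqn
    exact (Real.sqrt_le_left hM).1 hqn
  · have h1 : L (ι ⟨ψ, hψ⟩) = T ψ := by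
      rw [hL ⟨ι ⟨ψ, hψ⟩, LinearMap.mem_range_self _ _⟩]
      exact hR ⟨ψ, hψ⟩
    rw [← h1, ← InnerProductSpace.toDual_symm_apply, L2.inner_def]
    refine integral_congr_ae ?_
    filter_upwards [hψ.memLp.coeFn_toLp] with X hX
    have h2 : (ι ⟨ψ, hψ⟩ : ℝ × ℝ → ℝ) X = ψ X := hX
    rw [h2]
    simp [mul_comm, hq]

/-! ### Compactly supported `W^{1,2}` test functions -/

theorem continuous_integral_mul_comp_sub {F G : ℝ × ℝ → ℝ} (hF : MemLp F 2 volume)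
    (hG : MemLp G 2 volume) : Continuous fun Y => ∫ X, F X * G (X - Y) := by
  let τ : ℝ × ℝ → C(ℝ × ℝ, ℝ × ℝ) :=
    (ContinuousMap.mk (fun Z : (ℝ × ℝ) × (ℝ × ℝ) => Z.2 - Z.1) (by fun_prop)).curry
  have hτ : ∀ Y, MeasurePreserving (τ Y) volume volume := fun Y =>
    measurePreserving_sub_right volume Y
  have hc : Continuous fun Y => Lp.compMeasurePreserving (τ Y) (hτ Y) (hG.toLp G) :=
    (continuous_const (y := hG.toLp G)).compMeasurePreservingLp
      (ContinuousMap.continuous _) hτ (by simp)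
  have h1 := (continuous_const (y := hF.toLp F)).inner (𝕜 := ℝ) hc
  refine h1.congr fun Y => ?_
  rw [L2.inner_def]
  refine integral_congr_ae ?_
  filter_upwards [hF.coeFn_toLp, Lp.coeFn_compMeasurePreserving (hG.toLp G) (hτ Y),
    (hτ Y).quasiMeasurePreserving.ae hG.coeFn_toLp] with X h2 h3 h4
  rw [h2, h3, Function.comp_apply, h4]
  simp [τ, mul_comm]

/-- Fubini: averaging the correlation of `F` and `G` against `ρ` equals pairing `F` with the
convolution of `G` and `ρ`. The triple product is dominated by `(F² + G²)|ρ|`. -/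
theorem integral_integral_mul_comp_sub_mul {F G ρ : ℝ × ℝ → ℝ} (hF : MemLp F 2 volume)
    (hG : MemLp G 2 volume) (hρ : Continuous ρ) (hρc : HasCompactSupport ρ) :
    ∫ Y, (∫ X, F X * G (X - Y)) * ρ Y = ∫ X, F X * ∫ Z, G Z * ρ (X - Z) := by
  have hρi : Integrable ρ volume := hρ.integrable_of_hasCompactSupport hρc
  have h1 : Integrable (fun p : (ℝ × ℝ) × (ℝ × ℝ) => F p.1 ^ 2 * |ρ p.2|)
      (volume.prod volume) := hF.integrable_sq.mul_prod hρi.abs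
  have hmp := measurePreserving_sub_prod (G := ℝ × ℝ) volume volume
  have h2 : Integrable (fun p : (ℝ × ℝ) × (ℝ × ℝ) => G (p.1 - p.2) ^ 2 * |ρ p.2|)
      (volume.prod volume) :=
    hmp.integrable_comp_of_integrable (hG.integrable_sq.mul_prod hρi.abs)
  have hm1 : AEStronglyMeasurable (fun p : (ℝ × ℝ) × (ℝ × ℝ) => F p.1)
      (volume.prod volume) := hF.1.comp_quasiMeasurePreserving Measure.quasiMeasurePreserving_fst
  have hm2 : AEStronglyMeasurable (fun p : (ℝ × ℝ) × (ℝ × ℝ) => G (p.1 - p.2))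
      (volume.prod volume) :=
    (hG.1.comp_quasiMeasurePreserving
      (Measure.quasiMeasurePreserving_fst (ν := (volume : Measure (ℝ × ℝ))))).comp_measurePreserving
      hmp
  have hI : Integrable (fun p : (ℝ × ℝ) × (ℝ × ℝ) => F p.1 * G (p.1 - p.2) * ρ p.2)
      (volume.prod volume) := by
    refine (h1.add h2).mono' ((hm1.mul hm2).mul (hρ.comp continuous_snd).aestronglyMeasurable)
      (.of_forall fun p => ?_)
    have h3 : |F p.1 * G (p.1 - p.2)| ≤ F p.1 ^ 2 + G (p.1 - p.2) ^ 2 := by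
      rw [abs_le]
      constructor <;> nlinarith [sq_nonneg (F p.1 + G (p.1 - p.2)),
        sq_nonneg (F p.1 - G (p.1 - p.2)), sq_nonneg (F p.1), sq_nonneg (G (p.1 - p.2))]
    simp only [Real.norm_eq_abs, Pi.add_apply]
    rw [abs_mul, ← add_mul]
    exact mul_le_mul_of_nonneg_right h3 (abs_nonneg _)
  calc ∫ Y, (∫ X, F X * G (X - Y)) * ρ Y = ∫ Y, ∫ X, F X * G (X - Y) * ρ Y := by
        simp only [integral_mul_const]
    _ = ∫ X, ∫ Y, F X * G (X - Y) * ρ Y := (integral_integral_swap hI).symm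
    _ = ∫ X, F X * ∫ Z, G Z * ρ (X - Z) := by
        refine integral_congr_ae (.of_forall fun X => ?_)
        simp only [mul_assoc]
        rw [integral_const_mul, ← integral_sub_left_eq_self (fun Z => G Z * ρ (X - Z)) volume X]
        simp

theorem planeGradient_comp_const_sub {ρ : ℝ × ℝ → ℝ} (hρ : Differentiable ℝ ρ) (X Z : ℝ × ℝ)
    (i : Fin 2) :
    planeGradient (fun Z => ρ (X - Z)) Z i = -planeGradient ρ (X - Z) i := by
  have h1 : HasFDerivAt (fun Z : ℝ × ℝ => X - Z) (-ContinuousLinearMap.id ℝ (ℝ × ℝ)) Z :=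
    (hasFDerivAt_id Z).const_sub X
  have h2 := (hρ (X - Z)).hasFDerivAt.comp Z h1
  rw [planeGradient_eq, planeGradient_eq, HasFDerivAt.fderiv (f := fun Z => ρ (X - Z)) h2]
  simp

/-- Extends a divergence-free condition from smooth test functions to compactly supported functions
with an `L²` weak gradient, as needed to test the equation with `v η²`. No approximate identity is
chosen: the correlation `Φ(Y) = ∑ ∫ F_i(X) G_i(X - Y) dX` is continuous, and its integral against
any `ρ` supported near `0` is the condition tested with the mollification `f * ρ`. Hence `Φ`
vanishes near `0`, and `Φ(0)` is the desired sum. -/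
theorem sum_integral_mul_weakGradient_eq_zero {U K : Set (ℝ × ℝ)} {F G : ℝ × ℝ → Fin 2 → ℝ}
    {f : ℝ × ℝ → ℝ} (hU : IsOpen U) (hK : IsCompact K) (hKU : K ⊆ U)
    (hF : ∀ i, MemL2Loc U fun X => F X i)
    (h0 : ∀ φ, IsTestFunction U φ → ∑ i, ∫ X, F X i * planeGradient φ X i = 0)
    (hf : Integrable f volume) (hfK : ∀ X ∉ K, f X = 0)
    (hG : ∀ i, MemLp (fun X => G X i) 2 volume) (hGK : ∀ X ∉ K, ∀ i, G X i = 0)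
    (hfG : ∀ ψ, IsTestFunction Set.univ ψ → ∀ i,
      ∫ X, f X * planeGradient ψ X i = -∫ X, G X i * ψ X) :
    ∑ i, ∫ X, F X i * G X i = 0 := by
  -- Mollifying by `ρ` supported in the ball of radius `δ` keeps the support inside `U`.
  obtain ⟨δ, hδ, hδU⟩ := hK.exists_cthickening_subset_open hU hKU
  set K' := Metric.cthickening δ K
  have hK' : IsCompact K' := hK.cthickening
  have hKK' : K ⊆ K' := Metric.self_subset_cthickening K
  have hFi : ∀ i, MemLp (K'.indicator fun X => F X i) 2 volume := fun i =>
    (hF i).memLp_indicator hK' hδU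
  let Φ : ℝ × ℝ → ℝ := fun Y => ∑ i, ∫ X, K'.indicator (fun X => F X i) X * G (X - Y) i
  have hΦ : Continuous Φ := continuous_finsetSum _ fun i _ =>
    continuous_integral_mul_comp_sub (hFi i) (hG i)
  have hzero : ∀ ρ, IsTestFunction (Metric.ball 0 δ) ρ → ∫ Y, Φ Y * ρ Y = 0 := by
    intro ρ hρ
    let φ : ℝ × ℝ → ℝ := fun X => ∫ Z, f Z * ρ (X - Z)
    have hφ : φ = convolution f ρ (ContinuousLinearMap.mul ℝ ℝ) volume := rfl
    have hφsupp : tsupport φ ⊆ K' := by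
      refine closure_minimal (fun X hX => ?_) Metric.isClosed_cthickening
      by_contra hXK
      refine hX (integral_eq_zero_of_ae (.of_forall fun Z => ?_))
      by_cases hZ : Z ∈ K
      · have h1 : ρ (X - Z) = 0 := hρ.eq_zero_of_notMem fun h2 => hXK ?_
        · simp [h1]
        · refine Metric.mem_cthickening_of_dist_le X Z δ K hZ ?_
          rw [dist_eq_norm]
          exact (mem_ball_zero_iff.1 h2).le
      · simp [hfK Z hZ]
    have hφt : IsTestFunction U φ := by
      refine ⟨?_, hK'.of_isClosed_subset (isClosed_tsupport _) hφsupp, hφsupp.trans hδU⟩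
      rw [hφ]
      exact hρ.compact.contDiff_convolution_right _ hf.locallyIntegrable hρ.smooth
    have hφd : ∀ X i, planeGradient φ X i = ∫ Z, G Z i * ρ (X - Z) := by
      intro X i
      have h1 := hρ.compact.hasFDerivAt_convolution_right (ContinuousLinearMap.mul ℝ ℝ)
        hf.locallyIntegrable (hρ.smooth.of_le (by simp)) X
      have h2 : IsTestFunction Set.univ fun Z => ρ (X - Z) :=
        ⟨hρ.smooth.comp (contDiff_const.sub contDiff_id),
          hρ.compact.comp_homeomorph (Homeomorph.subLeft X), Set.subset_univ _⟩
      rw [planeGradient_eq, hφ, h1.fderiv, convolution_precompR_apply _ hf.locallyIntegrable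
        (hρ.compact.fderiv ℝ) (hρ.smooth.continuous_fderiv (by simp)), ← neg_neg (∫ Z, _),
        ← hfG _ h2 i, ← integral_neg]
      refine integral_congr_ae (.of_forall fun Z => ?_)
      simp only [planeGradient_comp_const_sub hρ.differentiable]
      simp [planeGradient_eq]
    have hint : ∀ i, Integrable (fun Y => (∫ X, K'.indicator (fun X => F X i) X * G (X - Y) i) *
        ρ Y) volume := fun i =>
      ((continuous_integral_mul_comp_sub (hFi i) (hG i)).mul
        hρ.smooth.continuous).integrable_of_hasCompactSupport hρ.compact.mul_left
    simp only [Φ, Finset.sum_mul]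
    rw [integral_finsetSum _ fun i _ => hint i, ← h0 φ hφt]
    refine Finset.sum_congr rfl fun i _ => ?_
    rw [integral_integral_mul_comp_sub_mul (hFi i) (hG i) hρ.smooth.continuous hρ.compact]
    simp only [← hφd]
    refine integral_congr_ae (.of_forall fun X => ?_)
    refine MemL2Loc.indicator_mul_eq (ψ := fun X => planeGradient φ X i) ?_ X
    simp only [planeGradient_eq]
    exact (tsupport_fderiv_apply_subset ℝ _).trans hφsupp
  have hae : ∀ᵐ Y, Y ∈ Metric.ball (0 : ℝ × ℝ) δ → Φ Y = 0 := by
    refine Metric.isOpen_ball.ae_eq_zero_of_integral_contDiff_smul_eq_zero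
      (hΦ.locallyIntegrable.locallyIntegrableOn _) fun ρ h1 h2 h3 => ?_
    simpa only [smul_eq_mul, mul_comm] using hzero ρ ⟨h1, h2, h3⟩
  have h1 : Set.EqOn Φ (fun _ => 0) (Metric.ball 0 δ) :=
    Measure.eqOn_open_of_ae_eq ((ae_restrict_iff' Metric.isOpen_ball.measurableSet).2 hae)
      Metric.isOpen_ball hΦ.continuousOn continuousOn_const
  refine Eq.trans ?_ (h1 (Metric.mem_ball_self hδ))
  refine Finset.sum_congr rfl fun i _ => integral_congr_ae (.of_forall fun X => ?_)
  by_cases hX : X ∈ K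
  · simp [hKK' hX]
  · simp [hGK X hX]

/-! ### Weak solutions, the Caccioppoli inequality and interior regularity -/

theorem HasWeakGradient.integral_mul_planeGradient {U : Set (ℝ × ℝ)} {v ψ : ℝ × ℝ → ℝ}
    {g : ℝ × ℝ → Fin 2 → ℝ} (h : HasWeakGradient U v g) (hψ : IsTestFunction U ψ) (i : Fin 2) :
    ∫ X, v X * planeGradient ψ X i = -∫ X, g X i * ψ X := by
  rw [← hψ.integral_mul, ← (hψ.partialDeriv i).integral_mul]
  exact h.weak ψ hψ i

/-- Product rule for the cut-off function `v κ`. Here `ψ` need not be supported in `U`, since `κ ψ`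
is. -/
theorem HasWeakGradient.integral_mul_testFunction {U : Set (ℝ × ℝ)} {v κ ψ : ℝ × ℝ → ℝ}
    {g : ℝ × ℝ → Fin 2 → ℝ} (h : HasWeakGradient U v g) (hκ : IsTestFunction U κ)
    (hψ : IsTestFunction Set.univ ψ) (i : Fin 2) :
    ∫ X, (v X * κ X) * planeGradient ψ X i =
      -∫ X, (g X i * κ X + v X * planeGradient κ X i) * ψ X := by
  have h1 : IsTestFunction U fun X => κ X * ψ X := by
    simpa only [mul_comm] using hκ.mul_left hψ.smooth
  have h2 : IsTestFunction U fun X => κ X * planeGradient ψ X i := by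
    simpa only [mul_comm] using hκ.mul_left (hψ.partialDeriv i).smooth
  have h3 : IsTestFunction U fun X => ψ X * planeGradient κ X i :=
    (hκ.partialDeriv i).mul_left hψ.smooth
  have h4 := h.integral_mul_planeGradient h1 i
  simp only [IsTestFunction.planeGradient_mul hκ.differentiable hψ.differentiable, mul_add] at h4
  rw [integral_add (h.memL2Loc.integrable_mul h2) (h.memL2Loc.integrable_mul h3)] at h4
  have h5 : ∫ X, (g X i * κ X + v X * planeGradient κ X i) * ψ X =
      (∫ X, g X i * (κ X * ψ X)) + ∫ X, v X * (ψ X * planeGradient κ X i) := by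
    rw [← integral_add ((h.gradient_memL2Loc i).integrable_mul h1) (h.memL2Loc.integrable_mul h3)]
    refine integral_congr_ae (.of_forall fun X => ?_)
    ring
  rw [h5]
  simp only [mul_assoc]
  linarith

section Elliptic

variable {lam Lam : ℝ} {A : ℝ → Matrix (Fin 2) (Fin 2) ℝ} {U : Set (ℝ × ℝ)} {v : ℝ × ℝ → ℝ}
  {g : ℝ × ℝ → Fin 2 → ℝ}

theorem IsElliptic.memL2Loc_mulVec (hA : IsElliptic lam Lam A) (hg : ∀ i, MemL2Loc U fun X => g X i)
    (i : Fin 2) : MemL2Loc U fun X => (A X.1 *ᵥ g X) i := by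
  have h1 : ∀ j, MemL2Loc U fun X => A X.1 i j * g X j := fun j =>
    (hg j).bdd_mul (m := fun x => A x i j) (hA.measurable i j)
      (hA.bounded.mono fun x hx => hx i j)
  simpa only [Matrix.mulVec, dotProduct, Fin.sum_univ_two] using (h1 0).add (h1 1)

theorem IsWeakSolution.sum_integral_eq_zero (hA : IsElliptic lam Lam A)
    (hv : IsWeakSolution A U v g) {ψ : ℝ × ℝ → ℝ} (hψ : IsTestFunction U ψ) :
    ∑ i, ∫ X, (A X.1 *ᵥ g X) i * planeGradient ψ X i = 0 := by
  rw [← integral_finsetSum _ fun i _ => (hA.memL2Loc_mulVec hv.hasWeakGradient.gradient_memL2Loc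
    i).integrable_mul (hψ.partialDeriv i), ← hv.equation ψ hψ]
  refine (setIntegral_eq_integral_of_forall_compl_eq_zero fun X hX => ?_).symm
  refine Finset.sum_eq_zero fun i _ => ?_
  rw [(hψ.partialDeriv i).eq_zero_of_notMem hX, mul_zero]

/-- Test the equation with `v η²`, use ellipticity on the main term, and absorb half of it by
Young's inequality. -/
theorem IsWeakSolution.caccioppoli (hlam : 0 < lam) (hU : IsOpen U) (hA : IsElliptic lam Lam A)
    (hv : IsWeakSolution A U v g) {η : ℝ × ℝ → ℝ} (hη : IsTestFunction U η) :
    ∫ X, ((g X 0 * η X) ^ 2 + (g X 1 * η X) ^ 2) ≤ 16 * Lam ^ 2 / lam ^ 2 *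
      ∫ X, ((v X * planeGradient η X 0) ^ 2 + (v X * planeGradient η X 1) ^ 2) := by
  have hw := hv.hasWeakGradient
  have hF := hA.memL2Loc_mulVec hw.gradient_memL2Loc
  have hκ : IsTestFunction U fun X => η X * η X := hη.mul_left hη.smooth
  set κ := fun X => η X * η X with hκdef
  have hκg : ∀ X i, planeGradient κ X i = 2 * (η X * planeGradient η X i) := fun X i => by
    rw [hκdef, IsTestFunction.planeGradient_mul hη.differentiable hη.differentiable]
    ring
  have hκv : ∀ X, κ X = η X * η X := fun _ => rfl
  have hκs : ∀ X ∉ tsupport η, κ X = 0 := fun X hX => by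
    simp [hκdef, image_eq_zero_of_notMem_tsupport hX]
  have hκs' : ∀ X ∉ tsupport η, ∀ i, planeGradient κ X i = 0 := fun X hX i => by
    simp [hκg, image_eq_zero_of_notMem_tsupport hX]
  have hzero := sum_integral_mul_weakGradient_eq_zero (f := fun X => v X * κ X)
    (F := fun X i => (A X.1 *ᵥ g X) i)
    (G := fun X i => g X i * κ X + v X * planeGradient κ X i) hU hη.compact hη.support hF
    (fun φ hφ => hv.sum_integral_eq_zero hA hφ) (hw.memL2Loc.integrable_mul hκ)
    (fun X hX => by simp [hκs X hX])
    (fun i => ((hw.gradient_memL2Loc i).memLp_mul hκ).add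
      (hw.memL2Loc.memLp_mul (hκ.partialDeriv i)))
    (fun X hX i => by simp [hκs X hX, hκs' X hX i])
    (fun ψ hψ i => hw.integral_mul_testFunction hκ hψ i)
  have hFη := fun i => (hF i).memLp_mul hη
  have hgη := fun i => (hw.gradient_memL2Loc i).memLp_mul hη
  have hvη := fun i => hw.memL2Loc.memLp_mul (hη.partialDeriv i)
  have hEi : ∀ i, Integrable (fun X => (A X.1 *ᵥ g X) i *
      (g X i * κ X + v X * planeGradient κ X i)) volume := fun i => by
    refine (((hFη i).integrable_mul (hgη i)).add
      (((hFη i).integrable_mul (hvη i)).const_mul 2)).congr (.of_forall fun X => ?_)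
    simp only [Pi.add_apply, Pi.mul_apply, hκg, hκv]
    ring
  rw [← integral_finsetSum _ fun i _ => hEi i] at hzero
  have hP : Integrable (fun X => (g X 0 * η X) ^ 2 + (g X 1 * η X) ^ 2) volume :=
    (hgη 0).integrable_sq.add (hgη 1).integrable_sq
  have hQ : Integrable (fun X => (v X * planeGradient η X 0) ^ 2 +
      (v X * planeGradient η X 1) ^ 2) volume := (hvη 0).integrable_sq.add (hvη 1).integrable_sq
  have hq : Measure.QuasiMeasurePreserving (Prod.fst : ℝ × ℝ → ℝ) volume volume :=
    Measure.quasiMeasurePreserving_fst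
  have hle : ∀ᵐ X, lam / 2 * ((g X 0 * η X) ^ 2 + (g X 1 * η X) ^ 2) ≤
      (∑ i, (A X.1 *ᵥ g X) i * (g X i * κ X + v X * planeGradient κ X i)) +
        8 * Lam ^ 2 / lam *
          ((v X * planeGradient η X 0) ^ 2 + (v X * planeGradient η X 1) ^ 2) := by
    filter_upwards [hq.ae hA.bounded, hq.ae hA.elliptic] with X hb he
    have he := he (g X)
    simp only [absVec, Real.sq_sqrt (add_nonneg (sq_nonneg (g X 0)) (sq_nonneg (g X 1))),
      dotProduct, Fin.sum_univ_two, hκg, hκv] at he ⊢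
    have hF0 : (A X.1 *ᵥ g X) 0 = A X.1 0 0 * g X 0 + A X.1 0 1 * g X 1 := by
      simp [Matrix.mulVec, dotProduct, Fin.sum_univ_two]
    have hF1 : (A X.1 *ᵥ g X) 1 = A X.1 1 0 * g X 0 + A X.1 1 1 * g X 1 := by
      simp [Matrix.mulVec, dotProduct, Fin.sum_univ_two]
    have hrow : ∀ a b x y : ℝ, |a| ≤ Lam → |b| ≤ Lam →
        (a * x + b * y) ^ 2 ≤ 2 * Lam ^ 2 * (x ^ 2 + y ^ 2) := by
      intro a b x y ha hb
      have ha2 : a ^ 2 ≤ Lam ^ 2 := sq_le_sq' (abs_le.1 ha).1 (abs_le.1 ha).2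
      have hb2 : b ^ 2 ≤ Lam ^ 2 := sq_le_sq' (abs_le.1 hb).1 (abs_le.1 hb).2
      nlinarith [sq_nonneg (a * x - b * y), mul_le_mul_of_nonneg_right ha2 (sq_nonneg x),
        mul_le_mul_of_nonneg_right hb2 (sq_nonneg y)]
    have hr0 := hrow _ _ (g X 0) (g X 1) (hb 0 0) (hb 0 1)
    have hr1 := hrow _ _ (g X 0) (g X 1) (hb 1 0) (hb 1 1)
    rw [← hF0] at hr0
    rw [← hF1] at hr1
    generalize (A X.1 *ᵥ g X) 0 = F0 at *
    generalize (A X.1 *ᵥ g X) 1 = F1 at *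
    generalize g X 0 = g0 at *
    generalize g X 1 = g1 at *
    generalize planeGradient η X 0 = n0
    generalize planeGradient η X 1 = n1
    generalize v X = w
    generalize η X = e
    -- Young's inequality with weight `lam / (8 * Lam ^ 2)`. Each of the two components of `A ∇v`
    -- costs `lam / 4` of the elliptic term, leaving `lam / 2`. The weight degenerates when `Lam =
    -- 0`, but then `F = 0`.
    have hyoung : ∀ F n : ℝ, F ^ 2 ≤ 2 * Lam ^ 2 * (g0 ^ 2 + g1 ^ 2) →
        -(lam / 4 * (e ^ 2 * (g0 ^ 2 + g1 ^ 2))) - 8 * Lam ^ 2 / lam * (w * n) ^ 2 ≤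
          2 * (F * e) * (w * n) := by
      intro F n hFn
      by_cases hL : Lam = 0
      · subst hL
        have hF0 : F = 0 := by nlinarith [sq_nonneg F]
        subst hF0
        have : 0 ≤ lam / 4 * (e ^ 2 * (g0 ^ 2 + g1 ^ 2)) := by positivity
        norm_num
        linarith
      · have hL2 : 0 < Lam ^ 2 := by positivity
        have h1 : lam / (8 * Lam ^ 2) * (F * e) ^ 2 ≤ lam / 4 * (e ^ 2 * (g0 ^ 2 + g1 ^ 2)) := by
          have := mul_le_mul_of_nonneg_left hFn (by positivity : 0 ≤ lam / (8 * Lam ^ 2) * e ^ 2)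
          calc _ = lam / (8 * Lam ^ 2) * e ^ 2 * F ^ 2 := by ring
            _ ≤ _ := this
            _ = _ := by field_simp; ring
        have h2 : 0 ≤ lam / (8 * Lam ^ 2) * (F * e + 8 * Lam ^ 2 / lam * (w * n)) ^ 2 := by
          positivity
        have h3 : lam / (8 * Lam ^ 2) * (F * e + 8 * Lam ^ 2 / lam * (w * n)) ^ 2 =
            lam / (8 * Lam ^ 2) * (F * e) ^ 2 + 2 * (F * e) * (w * n) +
              8 * Lam ^ 2 / lam * (w * n) ^ 2 := by
          field_simp
          ring
        linarith
    have hy0 := hyoung F0 n0 hr0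
    have hy1 := hyoung F1 n1 hr1
    have he' := mul_le_mul_of_nonneg_right he (sq_nonneg e)
    nlinarith
  have hint := integral_mono_ae (hP.const_mul (lam / 2))
    ((integrable_finsetSum _ fun i _ => hEi i).add (hQ.const_mul (8 * Lam ^ 2 / lam))) hle
  simp only [Pi.add_apply] at hint
  rw [integral_add (integrable_finsetSum _ fun i _ => hEi i) (hQ.const_mul (8 * Lam ^ 2 / lam)),
    hzero, zero_add, integral_const_mul, integral_const_mul] at hint
  have h1 := mul_le_mul_of_nonneg_left hint (by positivity : 0 ≤ 2 / lam)
  calc _ = 2 / lam * (lam / 2 * ∫ X, ((g X 0 * η X) ^ 2 + (g X 1 * η X) ^ 2)) := by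
        field_simp
    _ ≤ _ := h1
    _ = _ := by
        field_simp
        ring

/-- The coefficients depend on `x` alone, so a vertical translate of a solution solves the same
equation. -/
theorem IsWeakSolution.comp_add_sub {h : ℝ} (hup : ∀ X ∈ U, X + (0, h) ∈ U)
    (hA : IsElliptic lam Lam A) (hv : IsWeakSolution A U v g) :
    IsWeakSolution A U (fun X => v (X + (0, h)) - v X) (fun X i => g (X + (0, h)) i - g X i) := by
  have hw := hv.hasWeakGradient
  have hv1 := hw.memL2Loc.comp_add (0, h) hup
  have hg1 := fun i => (hw.gradient_memL2Loc i).comp_add (0, h) hup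
  have hs : ∀ ψ, IsTestFunction U ψ → IsTestFunction U fun X => ψ (X - (0, h)) := fun ψ hψ =>
    hψ.comp_sub _ fun X hX => hup X (hψ.support hX)
  refine ⟨⟨hv1.sub hw.memL2Loc, fun i => (hg1 i).sub (hw.gradient_memL2Loc i),
    fun ψ hψ i => ?_⟩, fun ψ hψ => ?_⟩
  · rw [(hψ.partialDeriv i).integral_mul, hψ.integral_mul]
    simp only [sub_mul]
    rw [integral_sub (hv1.integrable_mul (hψ.partialDeriv i))
      (hw.memL2Loc.integrable_mul (hψ.partialDeriv i)),
      integral_sub ((hg1 i).integrable_mul hψ) ((hw.gradient_memL2Loc i).integrable_mul hψ),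
      integral_comp_add_mul v (fun X => planeGradient ψ X i),
      integral_comp_add_mul (fun X => g X i), hw.integral_mul_planeGradient hψ]
    simp only [← IsTestFunction.planeGradient_comp_sub (ψ := ψ)]
    rw [hw.integral_mul_planeGradient (hs ψ hψ)]
    ring
  · have hF := hA.memL2Loc_mulVec hw.gradient_memL2Loc
    have hF1 := fun i => (hF i).comp_add (0, h) hup
    have h1 := hv.sum_integral_eq_zero hA hψ
    have h2 := hv.sum_integral_eq_zero hA (hs ψ hψ)
    simp only [IsTestFunction.planeGradient_comp_sub (ψ := ψ)] at h2
    have h3 : ∫ X in U, (A X.1 *ᵥ (fun i => g (X + (0, h)) i - g X i)) ⬝ᵥ planeGradient ψ X =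
        ∫ X, ∑ i, ((A (X + (0, h)).1 *ᵥ g (X + (0, h))) i * planeGradient ψ X i -
          (A X.1 *ᵥ g X) i * planeGradient ψ X i) := by
      refine Eq.trans ?_ (setIntegral_eq_integral_of_forall_compl_eq_zero (s := U)
        fun X hX => ?_)
      · refine integral_congr_ae (.of_forall fun X => ?_)
        simp only [dotProduct, Matrix.mulVec, Fin.sum_univ_two, Prod.fst_add, add_zero]
        ring
      · refine Finset.sum_eq_zero fun i _ => ?_
        rw [(hψ.partialDeriv i).eq_zero_of_notMem hX]
        ring
    have hi : ∀ i, Integrable (fun X => (A (X + (0, h)).1 *ᵥ g (X + (0, h))) i *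
        planeGradient ψ X i - (A X.1 *ᵥ g X) i * planeGradient ψ X i) volume := fun i =>
      ((hF1 i).integrable_mul (hψ.partialDeriv i)).sub
        ((hF i).integrable_mul (hψ.partialDeriv i))
    rw [h3, integral_finsetSum _ fun i _ => hi i]
    refine Eq.trans ?_ (sub_eq_zero.2 (h2.trans h1.symm))
    rw [← Finset.sum_sub_distrib]
    refine Finset.sum_congr rfl fun i _ => ?_
    rw [integral_sub ((hF1 i).integrable_mul (hψ.partialDeriv i))
      ((hF i).integrable_mul (hψ.partialDeriv i)),
      integral_comp_add_mul (fun X => (A X.1 *ᵥ g X) i) (fun X => planeGradient ψ X i)]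

end Elliptic

/-! ### The vertical derivative of the gradient of a weak solution -/

section VerticalDerivative

variable {lam Lam : ℝ} {A : ℝ → Matrix (Fin 2) (Fin 2) ℝ} {U : Set (ℝ × ℝ)} {u : ℝ × ℝ → ℝ}
  {g : ℝ × ℝ → Fin 2 → ℝ}

theorem IsWeakSolution.exists_diff_gradient_bound (hlam : 0 < lam) (hU : IsOpen U)
    (hup : ∀ X ∈ U, ∀ s : ℝ, 0 ≤ s → X + (0, s) ∈ U) (hA : IsElliptic lam Lam A)
    (hu : IsWeakSolution A U u g) {K : Set (ℝ × ℝ)} (hK : IsCompact K) (hKU : K ⊆ U) :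
    ∃ C : ℝ, 0 ≤ C ∧ ∀ h ∈ Set.Ioc (0 : ℝ) 1, ∀ ψ, IsTestFunction U ψ → tsupport ψ ⊆ K → ∀ i,
      |∫ X, (g (X + (0, h)) i - g X i) * ψ X| ≤ C * h * √(∫ X, ψ X ^ 2) := by
  obtain ⟨η, hη, hηK⟩ := exists_testFunction_eq_one hK hU hKU
  obtain ⟨V, hV, hηV, hVU, hVc⟩ :=
    exists_open_between_and_isCompact_closure hη.compact hU hη.support
  have hVU' : V ⊆ U := subset_closure.trans hVU
  -- `K₁` is swept out by moving `closure V` up through heights in `[0, 1]`; this is why `h ≤ 1` is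
  -- required. The norm of `u_t` on `K₁` then controls every difference on `V`.
  set K₁ : Set (ℝ × ℝ) := (fun p : (ℝ × ℝ) × ℝ => p.1 + (0, p.2)) '' (closure V ×ˢ Set.Icc 0 1)
  have hK₁ : IsCompact K₁ := (hVc.prod isCompact_Icc).image (by fun_prop)
  have hK₁U : K₁ ⊆ U := by
    rintro _ ⟨p, ⟨hp1, hp2⟩, rfl⟩
    exact hup _ (hVU hp1) _ hp2.1
  obtain ⟨B₀, hB₀, hB₀'⟩ := (hη.partialDeriv 0).exists_bound
  obtain ⟨B₁, hB₁, hB₁'⟩ := (hη.partialDeriv 1).exists_bound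
  have hw := hu.hasWeakGradient
  set D := √(∫ X, K₁.indicator (fun X => g X 1) X ^ 2)
  set E := √(16 * Lam ^ 2 / lam ^ 2 * ((B₀ ^ 2 + B₁ ^ 2) * D ^ 2))
  refine ⟨E, Real.sqrt_nonneg _, fun h hh ψ hψ hψK i => ?_⟩
  have hv := hu.comp_add_sub (fun X hX => hup X hX h hh.1.le) hA
  have hvw := hv.hasWeakGradient
  have hmono : ∀ {χ}, IsTestFunction V χ → IsTestFunction U χ := fun hχ =>
    hχ.mono (hχ.support.trans hVU')
  -- Duality converts the weak difference bound into an honest `L²` bound: `q` agrees with `u(· +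
  -- (0, h)) - u` almost everywhere on `V` and has norm at most `h * D`.
  obtain ⟨q, hq, hqn, hqv⟩ := exists_memLp_two_of_abs_le (U := V)
    (T := fun χ => ∫ X, (u (X + (0, h)) - u X) * χ X) (M := h * D)
    (mul_nonneg hh.1.le (Real.sqrt_nonneg _))
    (fun χ χ' hχ hχ' => by
      simp only [mul_add]
      exact integral_add (hvw.memL2Loc.integrable_mul (hmono hχ))
        (hvw.memL2Loc.integrable_mul (hmono hχ')))
    (fun a χ hχ => by
      simp only [mul_left_comm _ a]
      exact integral_const_mul _ _)
    (fun χ hχ => by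
      have hχU := hmono hχ
      have h1 := abs_integral_mul_comp_sub_sub_le hw.memL2Loc (hw.gradient_memL2Loc 1)
        (fun ψ hψ => hw.integral_mul_planeGradient hψ 1) hK₁ hK₁U hχU hh.1.le
        (fun X hX s hs => ⟨(X, s), ⟨subset_closure (hχ.support hX), hs.1, hs.2.trans hh.2⟩, rfl⟩)
      have h2 := hχU.comp_sub (V := U) (0, h) fun X hX => hup X (hχU.support hX) h hh.1.le
      simp only [sub_mul, mul_sub] at h1 ⊢
      rw [integral_sub (hw.memL2Loc.integrable_mul h2) (hw.memL2Loc.integrable_mul hχU)] at h1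
      rw [integral_sub ((hw.memL2Loc.comp_add (V := U) (0, h) fun X hX =>
        hup X hX h hh.1.le).integrable_mul hχU) (hw.memL2Loc.integrable_mul hχU),
        integral_comp_add_mul, mul_assoc]
      exact h1)
  have hqe : ∀ᵐ X, X ∈ V → u (X + (0, h)) - u X - q X = 0 := by
    refine ((hvw.memL2Loc.mono hVU').sub (hq.memL2Loc V)).ae_eq_zero hV fun χ hχ => ?_
    simp only [sub_mul _ (q _)]
    rw [integral_sub (hvw.memL2Loc.integrable_mul (hmono hχ))
      ((hq.memL2Loc V).integrable_mul hχ), ← hqv χ hχ, sub_self]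
  have hQ : ∫ X, (((u (X + (0, h)) - u X) * planeGradient η X 0) ^ 2 +
      ((u (X + (0, h)) - u X) * planeGradient η X 1) ^ 2) ≤ (B₀ ^ 2 + B₁ ^ 2) * (h * D) ^ 2 := by
    have h1 : ∀ᵐ X, ((u (X + (0, h)) - u X) * planeGradient η X 0) ^ 2 +
        ((u (X + (0, h)) - u X) * planeGradient η X 1) ^ 2 ≤ (B₀ ^ 2 + B₁ ^ 2) * q X ^ 2 := by
      filter_upwards [hqe] with X hX
      have h2 : planeGradient η X 0 ^ 2 ≤ B₀ ^ 2 :=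
        sq_le_sq' (abs_le.1 (hB₀' X)).1 (abs_le.1 (hB₀' X)).2
      have h3 : planeGradient η X 1 ^ 2 ≤ B₁ ^ 2 :=
        sq_le_sq' (abs_le.1 (hB₁' X)).1 (abs_le.1 (hB₁' X)).2
      by_cases hXV : X ∈ V
      · rw [sub_eq_zero.1 (hX hXV), mul_pow, mul_pow, ← mul_add, mul_comm]
        exact mul_le_mul_of_nonneg_right (add_le_add h2 h3) (sq_nonneg _)
      · have hη' := hη.mono hηV
        rw [(hη'.partialDeriv 0).eq_zero_of_notMem hXV,
          (hη'.partialDeriv 1).eq_zero_of_notMem hXV]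
        have : 0 ≤ (B₀ ^ 2 + B₁ ^ 2) * q X ^ 2 := by positivity
        simpa using this
    have h2 := integral_mono_ae ((hvw.memL2Loc.memLp_mul (hη.partialDeriv 0)).integrable_sq.add
      (hvw.memL2Loc.memLp_mul (hη.partialDeriv 1)).integrable_sq)
      (hq.integrable_sq.const_mul (B₀ ^ 2 + B₁ ^ 2)) h1
    rw [integral_const_mul] at h2
    exact h2.trans (mul_le_mul_of_nonneg_left hqn (by positivity))
  have hgη := fun i => (hvw.gradient_memL2Loc i).memLp_mul hη
  have hcac := (hv.caccioppoli hlam hU hA hη).trans (mul_le_mul_of_nonneg_left hQ (by positivity))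
  have hgi : ∫ X, ((g (X + (0, h)) i - g X i) * η X) ^ 2 ≤
      ∫ X, (((g (X + (0, h)) 0 - g X 0) * η X) ^ 2 + ((g (X + (0, h)) 1 - g X 1) * η X) ^ 2) := by
    refine integral_mono (hgη i).integrable_sq
      ((hgη 0).integrable_sq.add (hgη 1).integrable_sq) fun X => ?_
    fin_cases i
    · exact le_add_of_nonneg_right (sq_nonneg _)
    · exact le_add_of_nonneg_left (sq_nonneg _)
  have hcs := abs_integral_mul_le_sqrt (hgη i) hψ.memLp
  have hηψ : ∀ X, (g (X + (0, h)) i - g X i) * η X * ψ X = (g (X + (0, h)) i - g X i) * ψ X := by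
    intro X
    by_cases hX : X ∈ K
    · rw [hηK X hX, mul_one]
    · rw [image_eq_zero_of_notMem_tsupport fun h' => hX (hψK h'), mul_zero, mul_zero]
  simp only [hηψ] at hcs
  refine hcs.trans (mul_le_mul_of_nonneg_right ?_ (Real.sqrt_nonneg _))
  have hEh : E * h = √(16 * Lam ^ 2 / lam ^ 2 * ((B₀ ^ 2 + B₁ ^ 2) * D ^ 2) * h ^ 2) := by
    rw [Real.sqrt_mul (by positivity), Real.sqrt_sq hh.1.le]
  rw [hEh]
  refine Real.sqrt_le_sqrt ((hgi.trans hcac).trans (le_of_eq ?_))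
  ring

/-- Moving the difference onto `ψ` and dividing by `h`, the preceding bound survives the limit `h ↘
0`. -/
theorem IsWeakSolution.exists_vertical_deriv_bound (hlam : 0 < lam) (hU : IsOpen U)
    (hup : ∀ X ∈ U, ∀ s : ℝ, 0 ≤ s → X + (0, s) ∈ U) (hA : IsElliptic lam Lam A)
    (hu : IsWeakSolution A U u g) {K : Set (ℝ × ℝ)} (hK : IsCompact K) (hKU : K ⊆ U) :
    ∃ C : ℝ, 0 ≤ C ∧ ∀ ψ, IsTestFunction U ψ → tsupport ψ ⊆ K → ∀ i,
      |∫ X, g X i * planeGradient ψ X 1| ≤ C * √(∫ X, ψ X ^ 2) := by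
  obtain ⟨C, hC, hbound⟩ := hu.exists_diff_gradient_bound hlam hU hup hA hK hKU
  refine ⟨C, hC, fun ψ hψ hψK i => ?_⟩
  have hgi := hu.hasWeakGradient.gradient_memL2Loc i
  set K₁ : Set (ℝ × ℝ) := (fun p : (ℝ × ℝ) × ℝ => p.1 + (0, p.2)) '' (K ×ˢ Set.Icc 0 1)
  have hK₁ : IsCompact K₁ := (hK.prod isCompact_Icc).image (by fun_prop)
  have hK₁U : K₁ ⊆ U := by
    rintro _ ⟨p, ⟨hp1, hp2⟩, rfl⟩
    exact hup _ (hKU hp1) _ hp2.1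
  have hsub : ∀ s ∈ Set.Icc (0 : ℝ) 1, IsTestFunction K₁ fun X => ψ (X - (0, s)) := fun s hs =>
    hψ.comp_sub _ fun X hX => ⟨(X, s), ⟨hψK hX, hs⟩, rfl⟩
  have hd := hasDerivAt_integral_mul_comp_sub (hgi.integrable_indicator hK₁ hK₁U) hψ 0
  have hlim := hd.tendsto_slope_zero_right.abs
  have h0 : (0 : ℝ) ∈ Set.Icc (0 : ℝ) 1 := by simp
  have h0' := hsub 0 h0
  simp only [Prod.mk_zero_zero, sub_zero] at h0' hlim
  rw [abs_neg] at hlim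
  simp only [MemL2Loc.indicator_mul_eq (ψ := fun X => planeGradient ψ X 1)
    (h0'.partialDeriv 1).support] at hlim
  refine le_of_tendsto hlim ?_
  filter_upwards [Ioc_mem_nhdsGT (zero_lt_one' ℝ)] with h hh
  have h1 := hsub h ⟨hh.1.le, hh.2⟩
  have h2 := hbound h hh ψ hψ hψK i
  simp only [sub_mul] at h2
  rw [integral_sub ((hgi.comp_add (V := U) (0, h) fun X hX =>
    hup X hX h hh.1.le).integrable_mul hψ) (hgi.integrable_mul hψ),
    integral_comp_add_mul (fun X => g X i)] at h2
  simp only [zero_add, MemL2Loc.indicator_mul_eq h1.support, MemL2Loc.indicator_mul_eq h0'.support,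
    smul_eq_mul]
  rw [abs_mul, abs_inv, abs_of_pos hh.1, inv_mul_le_iff₀ hh.1]
  linarith

theorem IsWeakSolution.exists_vertical_deriv_of_compact (hlam : 0 < lam) (hU : IsOpen U)
    (hup : ∀ X ∈ U, ∀ s : ℝ, 0 ≤ s → X + (0, s) ∈ U) (hA : IsElliptic lam Lam A)
    (hu : IsWeakSolution A U u g) {K : Set (ℝ × ℝ)} (hK : IsCompact K) (hKU : K ⊆ U) (i : Fin 2) :
    ∃ q : ℝ × ℝ → ℝ, MemLp q 2 volume ∧ ∀ ψ, IsTestFunction K ψ →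
      ∫ X, g X i * planeGradient ψ X 1 = -∫ X, q X * ψ X := by
  obtain ⟨C, hC, hbound⟩ := hu.exists_vertical_deriv_bound hlam hU hup hA hK hKU
  have hgi := hu.hasWeakGradient.gradient_memL2Loc i
  have hmono : ∀ {χ}, IsTestFunction K χ → IsTestFunction U χ := fun hχ =>
    hχ.mono (hχ.support.trans hKU)
  obtain ⟨q, hq, -, hqv⟩ := exists_memLp_two_of_abs_le (U := K)
    (T := fun χ => ∫ X, g X i * planeGradient χ X 1) (M := C) hC
    (fun χ χ' hχ hχ' => by
      simp only [IsTestFunction.planeGradient_add hχ.differentiable hχ'.differentiable, mul_add]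
      exact integral_add (hgi.integrable_mul ((hmono hχ).partialDeriv 1))
        (hgi.integrable_mul ((hmono hχ').partialDeriv 1)))
    (fun a χ hχ => by
      simp only [IsTestFunction.planeGradient_const_mul hχ.differentiable, mul_left_comm _ a]
      exact integral_const_mul _ _)
    (fun χ hχ => hbound χ (hmono hχ) hχ.support i)
  refine ⟨fun X => -q X, hq.neg, fun ψ hψ => ?_⟩
  rw [hqv ψ hψ]
  simp [integral_neg]

end VerticalDerivative

/-! ### Local-to-global arguments in a graph domain -/

section GraphDomain

variable {lam Lam : ℝ} {A : ℝ → Matrix (Fin 2) (Fin 2) ℝ} {φ : ℝ → ℝ} {u : ℝ × ℝ → ℝ}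
  {g : ℝ × ℝ → Fin 2 → ℝ}

theorem isOpen_graphDomain (hφ : Continuous φ) : IsOpen (graphDomain φ) :=
  isOpen_lt (hφ.comp continuous_fst) continuous_snd

theorem add_mem_graphDomain {X : ℝ × ℝ} (hX : X ∈ graphDomain φ) {s : ℝ} (hs : 0 ≤ s) :
    X + (0, s) ∈ graphDomain φ := by
  simp only [graphDomain, Set.mem_ofPred_eq, Prod.fst_add, Prod.snd_add, add_zero] at hX ⊢
  linarith

/-- An exhaustion of the domain above the graph of `φ` by bounded sets. -/
def graphExhaustion (φ : ℝ → ℝ) (n : ℕ) : Set (ℝ × ℝ) :=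
  {X | ‖X‖ < n ∧ φ X.1 + 1 / ((n : ℝ) + 1) < X.2}

theorem isOpen_graphExhaustion (hφ : Continuous φ) (n : ℕ) : IsOpen (graphExhaustion φ n) :=
  (isOpen_lt continuous_norm continuous_const).inter
    (isOpen_lt ((hφ.comp continuous_fst).add continuous_const) continuous_snd)

theorem graphExhaustion_subset_isCompact (hφ : Continuous φ) (n : ℕ) :
    ∃ K, IsCompact K ∧ graphExhaustion φ n ⊆ K ∧ K ⊆ graphDomain φ := by
  refine ⟨Metric.closedBall 0 n ∩ {X | φ X.1 + 1 / ((n : ℝ) + 1) ≤ X.2},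
    (isCompact_closedBall _ _).inter_right
      (isClosed_le ((hφ.comp continuous_fst).add continuous_const) continuous_snd),
    fun X hX => ⟨mem_closedBall_zero_iff.2 hX.1.le, hX.2.le⟩, fun X hX => ?_⟩
  have h1 : 0 < 1 / ((n : ℝ) + 1) := by positivity
  exact (lt_add_of_pos_right _ h1).trans_le hX.2

theorem monotone_graphExhaustion (φ : ℝ → ℝ) : Monotone (graphExhaustion φ) := by
  intro n m hnm X hX
  have h1 : (n : ℝ) ≤ m := Nat.cast_le.2 hnm
  refine ⟨hX.1.trans_le h1, lt_of_le_of_lt ?_ hX.2⟩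
  gcongr

theorem exists_subset_graphExhaustion (hφ : Continuous φ) {K : Set (ℝ × ℝ)} (hK : IsCompact K)
    (hKφ : K ⊆ graphDomain φ) : ∃ n, K ⊆ graphExhaustion φ n := by
  refine hK.elim_directed_cover _ (isOpen_graphExhaustion hφ) (fun X hX => ?_)
    (monotone_graphExhaustion φ).directed_le
  have h1 : 0 < X.2 - φ X.1 := sub_pos.2 (hKφ hX)
  obtain ⟨n, hn⟩ := exists_nat_gt ‖X‖
  obtain ⟨m, hm⟩ := exists_nat_one_div_lt h1
  refine Set.mem_iUnion.2 ⟨max n m, hn.trans_le (Nat.cast_le.2 (le_max_left _ _)), ?_⟩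
  have h2 : 1 / (((max n m : ℕ) : ℝ) + 1) ≤ 1 / ((m : ℝ) + 1) := by
    gcongr
    exact le_max_right _ _
  linarith

theorem IsWeakSolution.exists_vertical_deriv (hlam : 0 < lam) (hφ : Continuous φ)
    (hA : IsElliptic lam Lam A) (hu : IsWeakSolution A (graphDomain φ) u g) (i : Fin 2) :
    ∃ q : ℝ × ℝ → ℝ, MemL2Loc (graphDomain φ) q ∧ ∀ ψ, IsTestFunction (graphDomain φ) ψ →
      ∫ X, g X i * planeGradient ψ X 1 = -∫ X, q X * ψ X := by
  have hex : ∀ n, ∃ q : ℝ × ℝ → ℝ, MemLp q 2 volume ∧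
      ∀ ψ, IsTestFunction (graphExhaustion φ n) ψ →
        ∫ X, g X i * planeGradient ψ X 1 = -∫ X, q X * ψ X := fun n => by
    obtain ⟨K, hK, hnK, hKφ⟩ := graphExhaustion_subset_isCompact hφ n
    obtain ⟨q, hq, hqv⟩ := hu.exists_vertical_deriv_of_compact hlam (isOpen_graphDomain hφ)
      (fun X hX s hs => add_mem_graphDomain hX hs) hA hK hKφ i
    exact ⟨q, hq, fun ψ hψ => hqv ψ (hψ.mono (hψ.support.trans hnK))⟩
  choose q hq hqv using hex
  have hcompat : ∀ n m, n ≤ m → ∀ᵐ X, X ∈ graphExhaustion φ n → q n X - q m X = 0 := by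
    intro n m hnm
    refine (((hq n).memL2Loc _).sub ((hq m).memL2Loc _)).ae_eq_zero
      (isOpen_graphExhaustion hφ n) fun ψ hψ => ?_
    simp only [sub_mul]
    rw [integral_sub (((hq n).memL2Loc _).integrable_mul hψ)
      (((hq m).memL2Loc _).integrable_mul hψ), sub_eq_zero, ← neg_inj, ← hqv n ψ hψ,
      ← hqv m ψ (hψ.mono (hψ.support.trans (monotone_graphExhaustion φ hnm)))]
  have hall : ∀ᵐ X, ∀ n m, n ≤ m → X ∈ graphExhaustion φ n → q n X - q m X = 0 :=
    ae_all_iff.2 fun n => ae_all_iff.2 fun m => by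
      by_cases h : n ≤ m
      · simpa [h] using hcompat n m h
      · simp [h]
  -- The local derivatives agree almost everywhere on overlaps, so they are glued by taking the
  -- first exhausting set containing `X`. The default value of `sInf` matters only off the domain.
  let Q : ℝ × ℝ → ℝ := fun X => q (sInf {n | X ∈ graphExhaustion φ n}) X
  have hQ : ∀ n, ∀ᵐ X, X ∈ graphExhaustion φ n → q n X = Q X := fun n => by
    filter_upwards [hall] with X hX hn
    have h1 : X ∈ graphExhaustion φ (sInf {n | X ∈ graphExhaustion φ n}) :=
      Nat.sInf_mem (s := {n | X ∈ graphExhaustion φ n}) ⟨n, hn⟩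
    exact (sub_eq_zero.1 (hX _ n (Nat.sInf_le hn) h1)).symm
  refine ⟨Q, fun K hKφ hK => ?_, fun ψ hψ => ?_⟩
  · obtain ⟨n, hn⟩ := exists_subset_graphExhaustion hφ hK hKφ
    refine ((hq n).restrict K).ae_eq ?_
    refine (ae_restrict_iff' hK.measurableSet).2 ?_
    filter_upwards [hQ n] with X hX hXK
    exact hX (hn hXK)
  · obtain ⟨n, hn⟩ := exists_subset_graphExhaustion hφ hψ.compact hψ.support
    rw [hqv n ψ (hψ.mono hn), neg_inj]
    refine integral_congr_ae ?_
    filter_upwards [hQ n] with X hX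
    by_cases hXn : X ∈ graphExhaustion φ n
    · rw [hX hXn]
    · rw [(hψ.mono hn).eq_zero_of_notMem hXn, mul_zero, mul_zero]

/-- The pairing of `f` with `ψ` is unchanged when `ψ` is shifted upwards, and the shifted support
ends up where `|f| ≤ ε`. -/
theorem ae_eq_zero_of_vertical_deriv_eq_zero (hφ : Continuous φ) {f : ℝ × ℝ → ℝ}
    (hf : MemL2Loc (graphDomain φ) f) (hv : VanishesAtInfinity (graphDomain φ) f)
    (h0 : ∀ ψ, IsTestFunction (graphDomain φ) ψ → ∫ X, f X * planeGradient ψ X 1 = 0) :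
    ∀ᵐ X, X ∈ graphDomain φ → f X = 0 := by
  refine hf.ae_eq_zero (isOpen_graphDomain hφ) fun ψ hψ => ?_
  have hs : ∀ h : ℝ, 0 ≤ h → IsTestFunction (graphDomain φ) fun X => ψ (X - (0, h)) :=
    fun h hh => hψ.comp_sub _ fun X hX => add_mem_graphDomain (hψ.support hX) hh
  have hshift : ∀ h : ℝ, 0 ≤ h → ∫ X, f X * ψ (X - (0, h)) = ∫ X, f X * ψ X := by
    intro h hh
    set K : Set (ℝ × ℝ) :=
      (fun p : (ℝ × ℝ) × ℝ => p.1 + (0, p.2)) '' (tsupport ψ ×ˢ Set.Icc 0 h)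
    have hK : IsCompact K := (IsCompact.prod hψ.compact isCompact_Icc).image (by fun_prop)
    have hKφ : K ⊆ graphDomain φ := by
      rintro _ ⟨p, ⟨hp1, hp2⟩, rfl⟩
      exact add_mem_graphDomain (hψ.support hp1) hp2.1
    have h1 := abs_integral_mul_comp_sub_sub_le (q := fun _ => 0) hf
      ((MemLp.zero' (p := 2) (μ := (volume : Measure (ℝ × ℝ)))).memL2Loc _)
      (fun ψ hψ => by simpa using h0 ψ hψ) hK hKφ hψ hh (fun X hX s hs => ⟨(X, s), ⟨hX, hs⟩, rfl⟩)
    simp only [mul_sub, Set.indicator_zero] at h1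
    rw [integral_sub (hf.integrable_mul (hs h hh)) (hf.integrable_mul hψ)] at h1
    have h2 : |(∫ X, f X * ψ (X - (0, h))) - ∫ X, f X * ψ X| ≤ 0 := by simpa using h1
    exact sub_eq_zero.1 (abs_nonpos_iff.1 h2)
  obtain ⟨B, hB⟩ := hψ.compact.isBounded.exists_norm_le
  have hle : ∀ ε > 0, |∫ X, f X * ψ X| ≤ ε * ∫ X, |ψ X| := by
    intro ε hε
    obtain ⟨R, hR⟩ := hv ε hε
    -- The support of `ψ` has heights at least `-|B|`, so after the shift all heights, and hence
    -- `absPt`, are at least `R`.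
    set h := |B| + |R|
    have hh : 0 ≤ h := by positivity
    rw [ae_restrict_iff' (isOpen_graphDomain hφ).measurableSet] at hR
    have hψi : Integrable ψ volume :=
      hψ.smooth.continuous.integrable_of_hasCompactSupport hψ.compact
    rw [← hshift h hh, ← integral_sub_right_eq_self (fun X => |ψ X|) ((0 : ℝ), h),
      ← integral_const_mul]
    refine abs_integral_le_integral_abs.trans (integral_mono_ae (hf.integrable_mul (hs h hh)).abs
      ((hψi.abs.comp_sub_right ((0 : ℝ), h)).const_mul ε) ?_)
    filter_upwards [hR] with X hX
    rw [abs_mul]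
    by_cases hXs : X - (0, h) ∈ tsupport ψ
    · refine mul_le_mul_of_nonneg_right (hX ?_ ?_) (abs_nonneg _)
      · simpa using add_mem_graphDomain (hψ.support hXs) hh
      · have h1 := (norm_snd_le _).trans (hB _ hXs)
        simp only [Prod.snd_sub, Real.norm_eq_abs] at h1
        have h2 : X.2 ≤ absPt X :=
          Real.le_sqrt_of_sq_le (le_add_of_nonneg_left (sq_nonneg _))
        have h3 := (abs_le.1 h1).1
        have h4 := le_abs_self R
        have h5 := le_abs_self B
        simp only [h] at h3
        linarith
    · simp [image_eq_zero_of_notMem_tsupport hXs]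
  have hI : 0 ≤ ∫ X, |ψ X| := integral_nonneg fun X => abs_nonneg _
  by_contra hne
  have hpos : 0 < |∫ X, f X * ψ X| := abs_pos.2 hne
  -- The `+ 1` keeps the denominator positive even if the integral of `|ψ|` is zero.
  have h1 := hle (|∫ X, f X * ψ X| / (2 * ((∫ X, |ψ X|) + 1))) (by positivity)
  rw [div_mul_eq_mul_div, le_div_iff₀ (by positivity)] at h1
  nlinarith

end GraphDomain

/-- Multiplication by a bounded function of `x` commutes with the weak `t`-derivative. -/
theorem integral_mul_fst_mul_planeGradient {U : Set (ℝ × ℝ)} {f q ψ : ℝ × ℝ → ℝ} {m : ℝ → ℝ}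
    {C : ℝ} (hf : MemL2Loc U f) (hq : MemL2Loc U q) (hm : AEMeasurable m volume)
    (hC : ∀ᵐ x, |m x| ≤ C)
    (hfq : ∀ ψ, IsTestFunction U ψ → ∫ X, f X * planeGradient ψ X 1 = -∫ X, q X * ψ X)
    (hψ : IsTestFunction U ψ) :
    ∫ X, (m X.1 * f X) * planeGradient ψ X 1 = -∫ X, (m X.1 * q X) * ψ X := by
  let Θ : ℝ × ℝ → ℝ := fun X => f X * planeGradient ψ X 1 + q X * ψ X
  have hΘ : Integrable Θ (volume.prod volume) :=
    (hf.integrable_mul (hψ.partialDeriv 1)).add (hq.integrable_mul hψ)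
  have hfubini : ∀ μ : ℝ → ℝ, Integrable (fun X : ℝ × ℝ => μ X.1 * Θ X) (volume.prod volume) →
      ∫ X, μ X.1 * Θ X = ∫ x, μ x * ∫ t, Θ (x, t) := fun μ hμ => by
    rw [Measure.volume_eq_prod, integral_prod _ hμ]
    simp only [integral_const_mul]
  -- The coefficient `m` is merely measurable, so `m ψ` is not a test function. Testing with `χ(x)
  -- ψ` for smooth `χ` shows that almost every vertical slice of `Θ` has integral zero, and a slice
  -- may then be multiplied by `m x`.
  have hzero : ∀ᵐ x, ∫ t, Θ (x, t) = 0 := by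
    refine ae_eq_zero_of_integral_contDiff_smul_eq_zero hΘ.integral_prod_left.locallyIntegrable
      fun χ hχ hχc => ?_
    have hχ' : ContDiff ℝ ∞ fun X : ℝ × ℝ => χ X.1 := hχ.comp contDiff_fst
    have hd : ∀ X, planeGradient (fun X => χ X.1 * ψ X) X 1 = χ X.1 * planeGradient ψ X 1 := by
      intro X
      have h1 : planeGradient (fun X : ℝ × ℝ => χ X.1) X 1 = 0 := by
        have h2 := ((hχ.differentiable (by simp) X.1).hasFDerivAt).comp X
          (hasFDerivAt_fst (𝕜 := ℝ) (p := X))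
        rw [planeGradient_eq, HasFDerivAt.fderiv (f := fun X : ℝ × ℝ => χ X.1) h2]
        simp [planeDir]
      rw [IsTestFunction.planeGradient_mul (hχ'.differentiable (by simp)) hψ.differentiable, h1,
        mul_zero, add_zero]
    have h1 := hψ.mul_left hχ'
    have h2 := hfq _ h1
    have h3 : IsTestFunction U fun X => χ X.1 * planeGradient ψ X 1 :=
      (hψ.partialDeriv 1).mul_left hχ'
    simp only [hd] at h2
    have h4 : ∀ X, χ X.1 * Θ X =
        f X * (χ X.1 * planeGradient ψ X 1) + q X * (χ X.1 * ψ X) := fun X => by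
      simp only [Θ]
      ring
    have h5 : Integrable (fun X : ℝ × ℝ => χ X.1 * Θ X) (volume.prod volume) := by
      simp only [h4]
      exact (hf.integrable_mul h3).add (hq.integrable_mul h1)
    simp only [smul_eq_mul]
    rw [← hfubini χ h5]
    simp only [h4]
    rw [integral_add (hf.integrable_mul h3) (hq.integrable_mul h1), h2, neg_add_cancel]
  have h1 := (hf.bdd_mul hm hC).integrable_mul (hψ.partialDeriv 1)
  have h2 := (hq.bdd_mul hm hC).integrable_mul hψ
  have h3 : ∀ X, (m X.1 * f X) * planeGradient ψ X 1 + (m X.1 * q X) * ψ X = m X.1 * Θ X :=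
    fun X => by
      simp only [Θ]
      ring
  rw [← add_eq_zero_iff_eq_neg, ← integral_add h1 h2]
  have h4 : Integrable (fun X : ℝ × ℝ => m X.1 * Θ X) (volume.prod volume) := by
    simp only [← h3]
    exact h1.add h2
  simp only [h3]
  rw [hfubini m h4]
  refine integral_eq_zero_of_ae ?_
  filter_upwards [hzero] with x hx
  simp [hx]

theorem planeGradient_comm {ψ : ℝ × ℝ → ℝ} (hψ : ContDiff ℝ ∞ ψ) (X : ℝ × ℝ) (i j : Fin 2) :
    planeGradient (fun X => planeGradient ψ X i) X j =
      planeGradient (fun X => planeGradient ψ X j) X i := by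
  have hd : DifferentiableAt ℝ (fderiv ℝ ψ) X :=
    (hψ.fderiv_right (m := ∞) (by simp)).differentiable (by simp) X
  have h1 : ∀ a b : ℝ × ℝ, fderiv ℝ (fun X => fderiv ℝ ψ X a) X b =
      fderiv ℝ (fderiv ℝ ψ) X b a := fun a b => by
    rw [fderiv_clm_apply hd (differentiableAt_const a)]
    simp
  have h2 : IsSymmSndFDerivAt ℝ ψ X := (contDiff_infty.1 hψ 2).contDiffAt.isSymmSndFDerivAt (by simp)
  simp only [planeGradient_eq, h1]
  exact h2 _ _

/-! ### The conjugate of the vertical derivative -/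

section Conjugate

variable {lam Lam : ℝ} {A : ℝ → Matrix (Fin 2) (Fin 2) ℝ} {φ : ℝ → ℝ} {u : ℝ × ℝ → ℝ}
  {g : ℝ × ℝ → Fin 2 → ℝ}

theorem ae_plane_of_ae {P : ℝ → Prop} (h : ∀ᵐ x, P x) : ∀ᵐ X : ℝ × ℝ, P X.1 :=
  (Measure.quasiMeasurePreserving_fst (μ := (volume : Measure ℝ))
    (ν := (volume : Measure ℝ))).ae h

theorem abs_le_absVec (ξ : Fin 2 → ℝ) (i : Fin 2) : |ξ i| ≤ absVec ξ := by
  rw [← Real.sqrt_sq_eq_abs]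
  refine Real.sqrt_le_sqrt ?_
  fin_cases i
  · exact le_add_of_nonneg_right (sq_nonneg _)
  · exact le_add_of_nonneg_left (sq_nonneg _)

theorem abs_add_mul_le {c : ℝ} (hc : |c| ≤ Lam) (ξ : Fin 2 → ℝ) :
    |ξ 0 + c * ξ 1| ≤ (1 + Lam) * absVec ξ := by
  have h1 : |c| * |ξ 1| ≤ Lam * absVec ξ :=
    mul_le_mul hc (abs_le_absVec ξ 1) (abs_nonneg _) ((abs_nonneg _).trans hc)
  calc |ξ 0 + c * ξ 1| ≤ |ξ 0| + |c| * |ξ 1| := by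
        rw [← abs_mul]
        exact abs_add_le _ _
    _ ≤ absVec ξ + Lam * absVec ξ := add_le_add (abs_le_absVec ξ 0) h1
    _ = _ := by ring

/-- The conjugate `u_x + c u_t` of `u_t`, together with its weak gradient
`(-d u_tt, u_xt + c u_tt)`. -/
theorem IsWeakSolution.exists_weakGradient_conjugate (hlam : 0 < lam) (hφ : Continuous φ)
    (hA : IsElliptic lam Lam A) (hA' : ∀ᵐ x : ℝ, A x = !![1, A x 0 1; 0, A x 1 1])
    (hu : IsWeakSolution A (graphDomain φ) u g) :
    ∃ q : ℝ × ℝ → Fin 2 → ℝ, HasWeakGradient (graphDomain φ) (fun X => g X 1) q ∧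
      HasWeakGradient (graphDomain φ) (fun X => g X 0 + A X.1 0 1 * g X 1)
        (fun X => ![-(A X.1 1 1 * q X 1), q X 0 + A X.1 0 1 * q X 1]) := by
  have hgi := hu.hasWeakGradient.gradient_memL2Loc
  choose r hr hrv using fun i => hu.exists_vertical_deriv hlam hφ hA i
  have hc : ∀ {f}, MemL2Loc (graphDomain φ) f →
      MemL2Loc (graphDomain φ) fun X => A X.1 0 1 * f X := fun hf =>
    hf.bdd_mul (m := fun x => A x 0 1) (hA.measurable 0 1) (hA.bounded.mono fun x hx => hx 0 1)
  have hd : ∀ {f}, MemL2Loc (graphDomain φ) f →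
      MemL2Loc (graphDomain φ) fun X => A X.1 1 1 * f X := fun hf =>
    hf.bdd_mul (m := fun x => A x 1 1) (hA.measurable 1 1) (hA.bounded.mono fun x hx => hx 1 1)
  have hcv : ∀ ψ, IsTestFunction (graphDomain φ) ψ → ∫ X, (A X.1 0 1 * g X 1) *
      planeGradient ψ X 1 = -∫ X, (A X.1 0 1 * r 1 X) * ψ X := fun ψ hψ =>
    integral_mul_fst_mul_planeGradient (m := fun x => A x 0 1) (hgi 1) (hr 1) (hA.measurable 0 1)
      (hA.bounded.mono fun x hx => hx 0 1) (hrv 1) hψ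
  have hdv : ∀ ψ, IsTestFunction (graphDomain φ) ψ → ∫ X, (A X.1 1 1 * g X 1) *
      planeGradient ψ X 1 = -∫ X, (A X.1 1 1 * r 1 X) * ψ X := fun ψ hψ =>
    integral_mul_fst_mul_planeGradient (m := fun x => A x 1 1) (hgi 1) (hr 1) (hA.measurable 1 1)
      (hA.bounded.mono fun x hx => hx 1 1) (hrv 1) hψ
  refine ⟨fun X i => r i X, ⟨hgi 1, hr, fun ψ hψ i => ?_⟩,
    ⟨(hgi 0).add (hc (hgi 1)), fun i => ?_, fun ψ hψ i => ?_⟩⟩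
  · rw [(hψ.partialDeriv i).integral_mul, hψ.integral_mul]
    -- Mixed derivatives commute on test functions, so the weak `i`-derivative of `u_t` is the
    -- `t`-derivative of component `i` of `∇u`.
    have h1 := hu.hasWeakGradient.integral_mul_planeGradient (hψ.partialDeriv i) 1
    have h2 := hu.hasWeakGradient.integral_mul_planeGradient (hψ.partialDeriv 1) i
    simp only [planeGradient_comm hψ.smooth _ i 1] at h1
    rw [h1, neg_inj] at h2
    rw [h2, hrv i ψ hψ]
  · fin_cases i
    · simpa using (hd (hr 1)).const_mul (-1)
    · exact (hr 0).add (hc (hr 1))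
  · rw [(hψ.partialDeriv i).integral_mul, hψ.integral_mul]
    fin_cases i
    -- The `x`-derivative of `u_x + c u_t` is read off from the equation, which trades it for `-∂_t
    -- (d u_t)`; no second `x`-derivative of `u` is needed.
    · have h1 := hu.sum_integral_eq_zero hA hψ
      rw [Fin.sum_univ_two] at h1
      have h2 : ∫ X, (A X.1 *ᵥ g X) 0 * planeGradient ψ X 0 =
          ∫ X, (g X 0 + A X.1 0 1 * g X 1) * planeGradient ψ X 0 := by
        refine integral_congr_ae ?_
        filter_upwards [ae_plane_of_ae hA'] with X hX
        rw [hX]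
        simp [Matrix.mulVec, dotProduct, Fin.sum_univ_two]
      have h3 : ∫ X, (A X.1 *ᵥ g X) 1 * planeGradient ψ X 1 =
          ∫ X, (A X.1 1 1 * g X 1) * planeGradient ψ X 1 := by
        refine integral_congr_ae ?_
        filter_upwards [ae_plane_of_ae hA'] with X hX
        rw [hX]
        simp [Matrix.mulVec, dotProduct, Fin.sum_univ_two]
      rw [h2, h3, hdv ψ hψ] at h1
      simp only [Fin.zero_eta, Matrix.cons_val_zero, neg_mul, integral_neg]
      linarith
    · simp only [Fin.mk_one, Matrix.cons_val_one, Matrix.cons_val_fin_one, add_mul]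
      rw [integral_add ((hgi 0).integrable_mul (hψ.partialDeriv 1))
        ((hc (hgi 1)).integrable_mul (hψ.partialDeriv 1)),
        integral_add ((hr 0).integrable_mul hψ) ((hc (hr 1)).integrable_mul hψ), hrv 0 ψ hψ,
        hcv ψ hψ]
      ring

theorem IsWeakSolution.isConjugatePair (hlam : 0 < lam) (hφ : Continuous φ)
    (hA : IsElliptic lam Lam A) (hA' : ∀ᵐ x : ℝ, A x = !![1, A x 0 1; 0, A x 1 1])
    (hu : IsWeakSolution A (graphDomain φ) u g) :
    IsConjugatePair A (graphDomain φ) (fun X => g X 1)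
      (fun X => g X 0 + A X.1 0 1 * g X 1) := by
  obtain ⟨q, hq, hw⟩ := hu.exists_weakGradient_conjugate hlam hφ hA hA'
  refine ⟨_, _, hq, hw, ae_restrict_of_ae ?_⟩
  filter_upwards [ae_plane_of_ae hA'] with X hX
  rw [hX]
  ext i
  fin_cases i <;> simp [Matrix.mulVec, dotProduct, Fin.sum_univ_two]

theorem vanishesAtInfinity_add_mul (hA : IsElliptic lam Lam A)
    (hg : IsBigOPow (graphDomain φ) (fun X => absVec (g X)) (-1)) :
    VanishesAtInfinity (graphDomain φ) (fun X => g X 0 + A X.1 0 1 * g X 1) := by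
  intro ε hε
  obtain ⟨M, R, hR⟩ := hg
  -- Beyond this radius `|X|` is positive and `(1 + Lam) * M / |X| ≤ ε`.
  refine ⟨max R (max 1 ((1 + Lam) * M / ε)), ?_⟩
  filter_upwards [hR, ae_restrict_of_ae (ae_plane_of_ae hA.bounded)] with X h1 h2 h3
  have hRX : R ≤ absPt X := (le_max_left _ _).trans h3
  have h1X : 1 ≤ absPt X := (le_max_left _ _).trans ((le_max_right _ _).trans h3)
  have hMX : (1 + Lam) * M / ε ≤ absPt X :=
    (le_max_right _ _).trans ((le_max_right _ _).trans h3)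
  have hpos : 0 < absPt X := by linarith
  have hL : 0 ≤ Lam := (abs_nonneg _).trans (h2 0 1)
  have h4 := (le_abs_self _).trans (h1 hRX)
  rw [Real.rpow_neg_one] at h4
  refine (abs_add_mul_le (h2 0 1) (g X)).trans
    ((mul_le_mul_of_nonneg_left h4 (by linarith)).trans ?_)
  rw [div_le_iff₀ hε] at hMX
  rw [← mul_assoc, ← div_eq_mul_inv, div_le_iff₀ hpos]
  linarith

theorem VanishesAtInfinity.sub {U : Set (ℝ × ℝ)} {v w : ℝ × ℝ → ℝ} (hv : VanishesAtInfinity U v)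
    (hw : VanishesAtInfinity U w) : VanishesAtInfinity U fun X => v X - w X := by
  intro ε hε
  obtain ⟨R, hR⟩ := hv (ε / 2) (half_pos hε)
  obtain ⟨S, hS⟩ := hw (ε / 2) (half_pos hε)
  refine ⟨max R S, ?_⟩
  filter_upwards [hR, hS] with X h1 h2 h3
  have h4 := h1 ((le_max_left _ _).trans h3)
  have h5 := h2 ((le_max_right _ _).trans h3)
  have h6 := abs_sub (v X) (w X)
  linarith

theorem IsWeakSolution.conjugate_unique (hlam : 0 < lam) (hφ : Continuous φ)
    (hA : IsElliptic lam Lam A) (hA' : ∀ᵐ x : ℝ, A x = !![1, A x 0 1; 0, A x 1 1])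
    (hu : IsWeakSolution A (graphDomain φ) u g)
    (hg : IsBigOPow (graphDomain φ) (fun X => absVec (g X)) (-1)) {w : ℝ × ℝ → ℝ}
    (hw : IsConjugatePair A (graphDomain φ) (fun X => g X 1) w)
    (hw0 : VanishesAtInfinity (graphDomain φ) w) :
    ∀ᵐ X, X ∈ graphDomain φ → w X = g X 0 + A X.1 0 1 * g X 1 := by
  have hU := isOpen_graphDomain hφ
  obtain ⟨q, hq, hv⟩ := hu.exists_weakGradient_conjugate hlam hφ hA hA'
  obtain ⟨gv, gw, hgv, hgw, heq⟩ := hw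
  have huniq : ∀ i, ∀ᵐ X, X ∈ graphDomain φ → gv X i - q X i = 0 := fun i => by
    refine ((hgv.gradient_memL2Loc i).sub (hq.gradient_memL2Loc i)).ae_eq_zero hU fun ψ hψ => ?_
    simp only [sub_mul]
    rw [integral_sub ((hgv.gradient_memL2Loc i).integrable_mul hψ)
      ((hq.gradient_memL2Loc i).integrable_mul hψ), sub_eq_zero, ← neg_inj,
      ← hgv.integral_mul_planeGradient hψ, ← hq.integral_mul_planeGradient hψ]
  rw [ae_restrict_iff' hU.measurableSet] at heq
  have hdiff : ∀ᵐ X, X ∈ graphDomain φ → w X - (g X 0 + A X.1 0 1 * g X 1) = 0 := by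
    refine ae_eq_zero_of_vertical_deriv_eq_zero hφ (hgw.memL2Loc.sub hv.memL2Loc)
      (hw0.sub (vanishesAtInfinity_add_mul hA hg)) fun ψ hψ => ?_
    simp only [sub_mul]
    rw [integral_sub (hgw.memL2Loc.integrable_mul (hψ.partialDeriv 1))
      (hv.memL2Loc.integrable_mul (hψ.partialDeriv 1)), hgw.integral_mul_planeGradient hψ,
      hv.integral_mul_planeGradient hψ, sub_eq_zero, neg_inj]
    refine integral_congr_ae ?_
    filter_upwards [heq, huniq 0, huniq 1, ae_plane_of_ae hA'] with X h1 h2 h3 h4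
    by_cases hX : X ∈ graphDomain φ
    -- The first row of the conjugacy relation determines the `t`-derivative of `w`, which suffices
    -- for uniqueness.
    · have h5 := congrFun (h1 hX) 0
      rw [h4] at h5
      simp only [Matrix.mulVec, dotProduct, Fin.sum_univ_two, Matrix.of_apply, Matrix.cons_val_zero,
        Matrix.cons_val_one, Matrix.cons_val_fin_one, Matrix.cons_val', zero_mul, one_mul,
        zero_add, sub_eq_zero.1 (h2 hX), sub_eq_zero.1 (h3 hX)] at h5
      simp only [Matrix.cons_val_one, Matrix.cons_val_fin_one, h5]
    · rw [hψ.eq_zero_of_notMem hX, mul_zero, mul_zero]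
  filter_upwards [hdiff] with X hX hXU
  exact sub_eq_zero.1 (hX hXU)

/-! ### Boundary values -/

theorem ae_surfaceMeasure_iff (hφ : Continuous φ) {P : ℝ × ℝ → Prop} :
    (∀ᵐ Q ∂(surfaceMeasure φ), P Q) ↔
      ∀ᵐ x ∂((volume : Measure ℝ).withDensity fun x =>
        ENNReal.ofReal (Real.sqrt (1 + deriv φ x ^ 2))), P (x, φ x) := by
  have h1 : MeasurableEmbedding fun x => (x, φ x) :=
    Continuous.measurableEmbedding (by fun_prop) fun x y h => (Prod.ext_iff.1 h).1
  exact h1.ae_map_iff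

/-- Transfers properties of the coefficients holding for almost every `x` to `σ`-almost every
boundary point. -/
theorem quasiMeasurePreserving_fst_surfaceMeasure (hφ : Continuous φ) :
    Measure.QuasiMeasurePreserving Prod.fst (surfaceMeasure φ) volume := by
  refine ⟨measurable_fst, ?_⟩
  rw [surfaceMeasure, Measure.map_map measurable_fst (by fun_prop)]
  have h1 : (Prod.fst ∘ fun x => (x, φ x)) = (id : ℝ → ℝ) := rfl
  rw [h1, Measure.map_id]
  exact withDensity_absolutelyContinuous _ _

theorem hasBoundaryValues_add_mul (hφ : Continuous φ) (hA : IsElliptic lam Lam A) {w : ℝ × ℝ → ℝ}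
    (hw : ∀ᵐ X, X ∈ graphDomain φ → w X = g X 0 + A X.1 0 1 * g X 1) {G : ℝ × ℝ → Fin 2 → ℝ}
    (hG : ∀ i, HasBoundaryValues φ (fun X => g X i) (fun Q => G Q i)) :
    HasBoundaryValues φ w (fun Q => G Q 0 + A Q.1 0 1 * G Q 1) := by
  have hq := quasiMeasurePreserving_fst_surfaceMeasure hφ
  refine ⟨(hG 0).measurable.add (((hA.measurable 0 1).comp_quasiMeasurePreserving
    hq).aestronglyMeasurable.mul (hG 1).measurable), ?_⟩
  rw [Measure.volume_eq_prod] at hw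
  -- By Fubini the formula for `w` holds at almost every height on almost every vertical line, which
  -- is enough for an essential limit.
  filter_upwards [(hG 0).tendsto, (hG 1).tendsto, hq.ae (Measure.ae_ae_of_ae_prod hw),
    (ae_surfaceMeasure_iff (P := fun Q => Q.2 = φ Q.1) hφ).2 (.of_forall fun x => rfl)]
    with Q h0 h1 h2 h3
  refine (h0.add (h1.const_mul (A Q.1 0 1))).congr' ?_
  have h4 : ∀ᵐ h : ℝ, (Q.1, Q.2 + h) ∈ graphDomain φ →
      w (Q.1, Q.2 + h) = g (Q.1, Q.2 + h) 0 + A Q.1 0 1 * g (Q.1, Q.2 + h) 1 :=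
    (measurePreserving_add_left volume Q.2).quasiMeasurePreserving.ae h2
  have h5 : ∀ᶠ h : ℝ in 𝓝[>] 0, (Q.1, Q.2 + h) ∈ graphDomain φ := by
    filter_upwards [self_mem_nhdsWithin] with h hh
    have hh : 0 < h := hh
    change φ Q.1 < Q.2 + h
    linarith
  filter_upwards [mem_inf_of_left h5, mem_inf_of_right h4] with h h6 h7
  exact (h7 h6).symm

theorem eLpNorm_add_mul_le (hφ : Continuous φ) (hA : IsElliptic lam Lam A)
    (G : ℝ × ℝ → Fin 2 → ℝ) (p : ℝ≥0∞) :
    eLpNorm (fun Q => G Q 0 + A Q.1 0 1 * G Q 1) p (surfaceMeasure φ) ≤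
      ENNReal.ofReal (1 + |Lam|) * eLpNorm (fun Q => absVec (G Q)) p (surfaceMeasure φ) := by
  refine eLpNorm_le_mul_eLpNorm_of_ae_le_mul ?_ p
  filter_upwards [(quasiMeasurePreserving_fst_surfaceMeasure hφ).ae hA.bounded] with Q hQ
  exact (abs_add_mul_le ((hQ 0 1).trans (le_abs_self _)) (G Q)).trans
    (mul_le_mul_of_nonneg_left (le_abs_self _) (by positivity))

end Conjugate

theorem mainTheorem6 (lam Lam : ℝ) (k : ℝ≥0) (p : ℝ) (hlam : 0 < lam) (hp : 1 < p) :
    ∃ C : ℝ, 0 < C ∧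
      ∀ (φ : ℝ → ℝ) (A : ℝ → Matrix (Fin 2) (Fin 2) ℝ)
        (u : ℝ × ℝ → ℝ) (gradu : ℝ × ℝ → Fin 2 → ℝ),
        LipschitzWith k φ →
        IsElliptic lam Lam A →
        (∀ᵐ x : ℝ, A x = !![1, A x 0 1; 0, A x 1 1]) →
        IsWeakSolution A (graphDomain φ) u gradu →
        (∀ δ > 0, IsBigOPow (graphDomain φ) u (δ - 1)) →
        (∀ δ > 0, IsBigOPow (graphDomain φ) (fun X => absVec (gradu X)) (δ - 2)) →
        (∃ w : ℝ × ℝ → ℝ,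
          IsConjugatePair A (graphDomain φ) (fun X => gradu X 1) w ∧
          VanishesAtInfinity (graphDomain φ) w) ∧
        ∀ w : ℝ × ℝ → ℝ,
          IsConjugatePair A (graphDomain φ) (fun X => gradu X 1) w →
          VanishesAtInfinity (graphDomain φ) w →
          ∀ G : ℝ × ℝ → Fin 2 → ℝ,
            (∀ i, HasBoundaryValues φ (fun X => gradu X i) (fun Q => G Q i)) →
            ∃ W : ℝ × ℝ → ℝ, HasBoundaryValues φ w W ∧
              eLpNorm W (ENNReal.ofReal p) (surfaceMeasure φ) ≤
                ENNReal.ofReal C *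
                  eLpNorm (fun Q => absVec (G Q)) (ENNReal.ofReal p) (surfaceMeasure φ) := by
  -- The absolute value keeps the constant positive without a sign assumption on `Lam`.
  refine ⟨1 + |Lam|, by positivity, fun φ A u gradu hφ hA hA' hu _ hgrad => ?_⟩
  have hφc : Continuous φ := hφ.continuous
  have hg : IsBigOPow (graphDomain φ) (fun X => absVec (gradu X)) (-1) := by
    -- The single choice `δ = 1` of the decay hypothesis suffices: `|∇u| = O(|X|⁻¹)`.
    have h1 := hgrad 1 one_pos
    norm_num at h1
    exact h1
  refine ⟨⟨_, hu.isConjugatePair hlam hφc hA hA', vanishesAtInfinity_add_mul hA hg⟩,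
    fun w hw hw0 G hG => ⟨_, hasBoundaryValues_add_mul hφc hA
      (hu.conjugate_unique hlam hφc hA hA' hg hw hw0) hG, eLpNorm_add_mul_le hφc hA G _⟩⟩
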